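/- **Setting.** Let $Q$ be a connected, geodesically complete, flat Riemannian manifold of dimension $n$ (Hausdorff and smooth; flat means locally isometric to Euclidean space), with metric $\sigma$, and let $P=T^*Q$. On $P$ take the lifted metric $G(V,V)=|T\pi V|^2+\left|\tfrac{Dp}{dt}\right|^2$ and the complex structure $J$ whose complex coordinates over a flat (isometric) chart $q$ of $Q$ are $z^i=q^i+\mathrm i\,p_i$; in these coordinates $G$ is the Euclidean metric of $\mathbb C^n$. Fix $o\in P$ and a basis $b_1,\dots,b_n$ of $T_{\pi(o)}Q$. It identifies $T_oP$ with $\mathbb C^n$: $z=u+\mathrm i v$ is the tangent vector $V$ with $T\pi V=\sum_i u^i b_i$ and $\sigma^\sharp\tfrac{Dp}{dt}=\sum_i v^i b_i$. Put $|z|^2=G_o(z,z)=\sum_{i,j}\sigma(b_i,b_j)z^i\overline{z^j}$, let $dz$ be the Lebesgue measure of $\mathbb C^n$, let $\exp_o:T_oP\to P$ be the exponential map of $(P,G)$, and assume that $\exp_o$ is surjective. Let $\mathcal B$ be the Segal–Bargmann space of entire functions $f$ on $T_oP\cong\mathbb C^n$ with $\int|f|^2e^{-|z|^2}dz<\infty$,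 and let $\mathcal B_P$ be the space of holomorphic functions $\phi$ on $P$ with $\int_{T_oP}|\phi(\exp_o z)|^2e^{-|z|^2}dz<\infty$, with the scalar product $$\langle\phi,\psi\rangle=\int_{T_oP}\overline{\phi(\exp_o z)}\,\psi(\exp_o z)\,e^{-|z|^2}\,dz .$$ A *reproducing kernel* of $\mathcal B_P$ is a function $K_P:P\times P\to\mathbb C$ that is holomorphic in the first variable, such that $\overline{K_P(m,\cdot)}\in\mathcal B_P$ for every $m\in P$ (so $K_P$ is antiholomorphic in the second variable), and such that for all $\phi\in\mathcal B_P$ and $m\in P$ $$\phi(m)=\int_{T_oP}K_P(m,\exp_o w)\,\phi(\exp_o w)\,e^{-|w|^2}\,dw .$$ A *Segal–Bargmann kernel* is a function $K:\mathbb C^n\times\mathbb C^n\to\mathbb C$ with $K(\cdot,w)\in\mathcal B$ and $\overline{K(z,\cdot)}\in\mathcal B$ for all $z,w$, and $f(z)=\int K(z,w)f(w)e^{-|w|^2}dw$ for all $f\in\mathcal B$ and $z\in\mathbb C^n$. **Theorem.** Let $\{e_j\}$ be an orthonormal basis of $\mathcal B_P$. Then: 1. For all $m,m'\in P$, $\sum_j|e_j(m)\overline{e_j(m')}|<\infty$.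 2. $\mathcal B_P$ has exactly one reproducing kernel $K_P$, and for all $m,m'\in P$ $$K_P(m,m')=\sum_j e_j(m)\overline{e_j(m')} .$$ 3. There is exactly one Segal–Bargmann kernel $K$, and for every $w\in T_oP$ the function $z\mapsto K_P(\exp_o z,\exp_o w)$ is the orthogonal projection of $K(\cdot,w)$ onto the subspace $\{\phi\circ\exp_o:\phi\in\mathcal B_P\}$ of $\mathcal B$. -/

import Mathlib

open Set Filter Topology MeasureTheory Manifold Bundle
open scoped ContDiff ComplexConjugate

noncomputable section

namespace FlatPhaseSpace

/-- Euclidean `n`-space, the model space of the configuration manifold. -/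
abbrev Euc (n : ℕ) : Type := EuclideanSpace ℝ (Fin n)

/-- The tangent space of the configuration manifold `Q` at `q`. -/
abbrev TQ {n : ℕ} {Q : Type*} [TopologicalSpace Q] [ChartedSpace (Euc n) Q] (q : Q) : Type :=
  TangentSpace 𝓘(ℝ, Euc n) q

/-- The cotangent bundle (phase space) `P = T*Q`: a point is a pair `⟨q, p⟩` with `q : Q` and
`p` a linear form on the tangent space at `q`. -/
abbrev Phase (n : ℕ) (Q : Type*) [TopologicalSpace Q] [ChartedSpace (Euc n) Q] : Type _ :=
  TotalSpace (Euc n →L[ℝ] ℝ) (fun q : Q => TQ (n := n) q →L[ℝ] ℝ)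

section Geometry

variable {n : ℕ} {Q : Type*} [TopologicalSpace Q] [ChartedSpace (Euc n) Q]

/-- The differential at `q` of a chart `κ`, as a map from the tangent space at `q` to `ℝⁿ`. -/
def chartDeriv (κ : OpenPartialHomeomorph Q (Euc n)) (q : Q) : TQ (n := n) q →L[ℝ] Euc n :=
  mfderiv 𝓘(ℝ, Euc n) 𝓘(ℝ, Euc n) κ q

/-- Coordinatewise real part of a vector of `ℂⁿ`. -/
def rePart (z : Fin n → ℂ) : Euc n := WithLp.toLp 2 (fun i => (z i).re)

/-- Coordinatewise imaginary part of a vector of `ℂⁿ`. -/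
def imPart (z : Fin n → ℂ) : Euc n := WithLp.toLp 2 (fun i => (z i).im)

/-- The inverse of the cotangent chart induced by a chart `κ` of `Q`: `z = x + i y` is sent to the
covector `p = ∑ yᵢ dκⁱ` at the point `κ⁻¹(x)`. If `κ` is isometric, the metric coefficients are
`δᵢⱼ` and the Christoffel symbols vanish, so that `zⁱ = qⁱ + i pᵢ` are the complex coordinates of
the almost complex structure `J` of `T*Q`
(`żⁱ = q̇ⁱ + i σⁱᵐ (ṗₘ - pₖ Γᵏₘₗ q̇ˡ) = q̇ⁱ + i ṗᵢ`), and the lifted metric `G` is the Euclidean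
metric of `ℂⁿ`. -/
def cotangentParam (κ : OpenPartialHomeomorph Q (Euc n)) (z : Fin n → ℂ) : Phase n Q :=
  ⟨κ.symm (rePart z), (innerSL ℝ (imPart z)).comp (chartDeriv κ (κ.symm (rePart z)))⟩

/-- The domain in `ℂⁿ` of the parametrization `cotangentParam κ`, namely `κ.target + i ℝⁿ`. -/
def cotangentDomain (κ : OpenPartialHomeomorph Q (Euc n)) : Set (Fin n → ℂ) :=
  {z | rePart z ∈ κ.target}

variable [RiemannianBundle (fun q : Q => TQ (n := n) q)]

/-- A flat chart: a smooth chart of `Q` which is a Riemannian isometry onto an open subset of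
Euclidean space. -/
structure IsFlatChart (κ : OpenPartialHomeomorph Q (Euc n)) : Prop where
  smooth : κ ∈ IsManifold.maximalAtlas 𝓘(ℝ, Euc n) ∞ Q
  isometric : ∀ q ∈ κ.source, ∀ v w : TQ (n := n) q,
    inner ℝ (chartDeriv κ q v) (chartDeriv κ q w) = inner ℝ v w

variable (n Q) in
/-- `Q` is a flat Riemannian manifold: it is locally isometric to Euclidean space. -/
def IsFlat : Prop :=
  ∀ q : Q, ∃ κ : OpenPartialHomeomorph Q (Euc n), IsFlatChart κ ∧ q ∈ κ.source

/-- Geodesics of the flat manifold `Q`, parametrized by `ℝ`: in flat charts the Christoffel symbols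
vanish and the solutions of the geodesic equation are the affine curves. -/
def IsGeodesicBase (γ : ℝ → Q) : Prop :=
  ∀ t₀ : ℝ, ∃ (κ : OpenPartialHomeomorph Q (Euc n)) (x v : Euc n), IsFlatChart κ ∧ x ∈ κ.target ∧
    ∀ᶠ t in 𝓝 t₀, γ t = κ.symm (x + (t - t₀) • v)

variable (n Q) in
/-- `Q` is geodesically complete: for every `q` and every tangent vector `v` at `q` there is a
geodesic defined on the whole of `ℝ` which starts at `q` with velocity `v`. -/
def GeodesicallyComplete : Prop :=
  ∀ (q : Q) (v : TQ (n := n) q), ∃ γ : ℝ → Q, IsGeodesicBase (n := n) γ ∧ γ 0 = q ∧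
    ∃ κ : OpenPartialHomeomorph Q (Euc n), IsFlatChart κ ∧ q ∈ κ.source ∧
      HasDerivAt (fun t => κ (γ t)) (chartDeriv κ q v) 0

/-- Geodesics, parametrized by `ℝ`, of the phase space `P = T*Q` with its lifted metric `G`: in the
complex coordinates of a flat chart, `G` is the Euclidean metric, and the solutions of the geodesic
equation are the affine curves. -/
def IsGeodesic (γ : ℝ → Phase n Q) : Prop :=
  ∀ t₀ : ℝ, ∃ (κ : OpenPartialHomeomorph Q (Euc n)) (w V : Fin n → ℂ),
    IsFlatChart κ ∧ w ∈ cotangentDomain κ ∧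
      ∀ᶠ t in 𝓝 t₀, γ t = cotangentParam κ (w + ((t - t₀ : ℝ) : ℂ) • V)

/-- Let `b` be a basis of the tangent space at the base point of `o`. It gives linear complex
coordinates `z = u + i v` on the tangent space of `P` at `o`: `u` is the vector of components in
`b` of the projection to `Q` of the tangent vector, and `v` is the vector of components in `b` of
its vertical part (the covariant derivative of the momentum), with the index raised.
In the complex coordinates of a flat chart `κ` the vector with coordinates `z` is
`∑ zᵢ dκ(bᵢ)`. -/
def velocity (κ : OpenPartialHomeomorph Q (Euc n)) {q : Q} (b : Module.Basis (Fin n) ℝ (TQ (n := n) q))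
    (z : Fin n → ℂ) : Fin n → ℂ :=
  fun k => ∑ i, z i * ((chartDeriv κ q (b i) k : ℝ) : ℂ)

/-- The curve `γ` in `P` starts at time `0` at `o`, moving there along a straight line of a flat
chart with velocity the tangent vector with complex coordinates `z` in the basis `b`. -/
def StartsWith (o : Phase n Q) (b : Module.Basis (Fin n) ℝ (TQ (n := n) o.proj)) (z : Fin n → ℂ)
    (γ : ℝ → Phase n Q) : Prop :=
  ∃ (κ : OpenPartialHomeomorph Q (Euc n)) (w : Fin n → ℂ),
    IsFlatChart κ ∧ w ∈ cotangentDomain κ ∧ cotangentParam κ w = o ∧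
      ∀ᶠ t : ℝ in 𝓝 0, γ t = cotangentParam κ (w + (t : ℂ) • velocity κ b z)

open Classical in
/-- The exponential map of `P` at `o`, in the complex coordinates on the tangent space at `o` given
by the basis `b`: the value at time `1` of the geodesic which starts at `o` with velocity `z`.
(The value `o` is used only if there is no such geodesic.) -/
def expMap (o : Phase n Q) (b : Module.Basis (Fin n) ℝ (TQ (n := n) o.proj)) (z : Fin n → ℂ) :
    Phase n Q :=
  if h : ∃ γ : ℝ → Phase n Q, IsGeodesic γ ∧ StartsWith o b z γ then h.choose 1 else o

/-- A function on `P = T*Q` is holomorphic if it is so in the complex coordinates of every flat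
chart. -/
def Holomorphic (φ : Phase n Q → ℂ) : Prop :=
  ∀ κ : OpenPartialHomeomorph Q (Euc n), IsFlatChart κ →
    DifferentiableOn ℂ (fun z => φ (cotangentParam κ z)) (cotangentDomain κ)

/-- The square modulus `|z|² = G(z, z) = ∑ σᵢⱼ zⁱ conj(zʲ)` of a tangent vector of `P` with complex
coordinates `z` in the basis `b`, where `σᵢⱼ = ⟪bᵢ, bⱼ⟫`. -/
def modSq {q : Q} (b : Module.Basis (Fin n) ℝ (TQ (n := n) q)) (z : Fin n → ℂ) : ℝ :=
  (∑ i, ∑ j, ((inner ℝ (b i) (b j) : ℝ) : ℂ) * z i * conj (z j)).re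

/-- The Gaussian measure `e^{-|z|²} dz`, with `dz` the Lebesgue measure of `ℂⁿ`. -/
def gaussian {q : Q} (b : Module.Basis (Fin n) ℝ (TQ (n := n) q)) : Measure (Fin n → ℂ) :=
  volume.withDensity (fun z => ENNReal.ofReal (Real.exp (-modSq b z)))

/-- The scalar product `∫ conj(f(z)) g(z) e^{-|z|²} dz`. -/
def scalar {q : Q} (b : Module.Basis (Fin n) ℝ (TQ (n := n) q)) (f g : (Fin n → ℂ) → ℂ) : ℂ :=
  ∫ z, conj (f z) * g z ∂(gaussian b)

/-- The Segal-Bargmann space `𝓑` of entire functions on the tangent space which are square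
integrable for `e^{-|z|²} dz`. -/
def segalBargmann {q : Q} (b : Module.Basis (Fin n) ℝ (TQ (n := n) q)) :
    Submodule ℂ ((Fin n → ℂ) → ℂ) where
  carrier := {f | Differentiable ℂ f ∧ MemLp f 2 (gaussian b)}
  zero_mem' := ⟨differentiable_const 0, MemLp.zero⟩
  add_mem' hf hg := ⟨hf.1.add hg.1, hf.2.add hg.2⟩
  smul_mem' c _ hf := ⟨hf.1.const_smul c, hf.2.const_smul c⟩

/-- The space `𝓑_P` of holomorphic functions `φ` on `P` such that `φ ∘ exp_o` is square integrable
for `e^{-|z|²} dz`. -/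
def holoL2 (o : Phase n Q) (b : Module.Basis (Fin n) ℝ (TQ (n := n) o.proj)) :
    Submodule ℂ (Phase n Q → ℂ) where
  carrier := {φ | Holomorphic φ ∧ MemLp (fun z => φ (expMap o b z)) 2 (gaussian b)}
  zero_mem' := ⟨fun _ _ => differentiableOn_const 0, MemLp.zero⟩
  add_mem' hf hg := ⟨fun κ hκ => (hf.1 κ hκ).add (hg.1 κ hκ), hf.2.add hg.2⟩
  smul_mem' c _ hf := ⟨fun κ hκ => (hf.1 κ hκ).const_smul c, hf.2.const_smul c⟩

/-- The scalar product `⟨φ, ψ⟩ = ∫ conj(φ(exp_o z)) ψ(exp_o z) e^{-|z|²} dz` of functions on `P`. -/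
def phaseScalar (o : Phase n Q) (b : Module.Basis (Fin n) ℝ (TQ (n := n) o.proj))
    (φ ψ : Phase n Q → ℂ) : ℂ :=
  scalar b (fun z => φ (expMap o b z)) (fun z => ψ (expMap o b z))

/-- The pull-back `φ ↦ φ ∘ exp_o` of functions on `P` to functions on the tangent space at `o`. -/
def expPullback (o : Phase n Q) (b : Module.Basis (Fin n) ℝ (TQ (n := n) o.proj)) :
    (Phase n Q → ℂ) →ₗ[ℂ] ((Fin n → ℂ) → ℂ) :=
  LinearMap.funLeft ℂ ℂ (expMap o b)

open Classical in
/-- Orthonormal bases of `𝓑_P`: orthonormal families in `𝓑_P` whose linear span is dense. -/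
structure IsOrthonormalBasis (o : Phase n Q) (b : Module.Basis (Fin n) ℝ (TQ (n := n) o.proj))
    {ι : Type*} (e : ι → Phase n Q → ℂ) : Prop where
  mem : ∀ j, e j ∈ holoL2 o b
  orthonormal : ∀ j k, phaseScalar o b (e j) (e k) = if j = k then 1 else 0
  dense : ∀ φ ∈ holoL2 o b, ∀ ε : ℝ, 0 < ε → ∃ ψ ∈ Submodule.span ℂ (range e),
    ∫ z, ‖φ (expMap o b z) - ψ (expMap o b z)‖ ^ 2 ∂(gaussian b) < ε

/-- `K` is a reproducing kernel of `𝓑_P`: it is holomorphic in the first variable, it is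
antiholomorphic and square integrable in the second one, and
`φ(m) = ∫ K(m, exp_o w) φ(exp_o w) e^{-|w|²} dw` for all `φ` in `𝓑_P`. -/
structure IsReproducingKernel (o : Phase n Q) (b : Module.Basis (Fin n) ℝ (TQ (n := n) o.proj))
    (K : Phase n Q → Phase n Q → ℂ) : Prop where
  holomorphic : ∀ m', Holomorphic (fun m => K m m')
  conj_mem : ∀ m, (fun m' => conj (K m m')) ∈ holoL2 o b
  reproducing : ∀ φ ∈ holoL2 o b, ∀ m,
    φ m = ∫ w, K m (expMap o b w) * φ (expMap o b w) ∂(gaussian b)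

/-- `K` is the Segal-Bargmann kernel, that is, the reproducing kernel of the Segal-Bargmann
space. -/
structure IsSegalBargmannKernel {q : Q} (b : Module.Basis (Fin n) ℝ (TQ (n := n) q))
    (K : (Fin n → ℂ) → (Fin n → ℂ) → ℂ) : Prop where
  mem : ∀ w, (fun z => K z w) ∈ segalBargmann b
  conj_mem : ∀ z, (fun w => conj (K z w)) ∈ segalBargmann b
  reproducing : ∀ f ∈ segalBargmann b, ∀ z, f z = ∫ w, K z w * f w ∂(gaussian b)

/-- `g` is the orthogonal projection of `f` onto the space of functions `S`. -/
def IsOrthogonalProjection {q : Q} (b : Module.Basis (Fin n) ℝ (TQ (n := n) q))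
    (S : Submodule ℂ ((Fin n → ℂ) → ℂ)) (f g : (Fin n → ℂ) → ℂ) : Prop :=
  g ∈ S ∧ ∀ h ∈ S, scalar b h (fun z => f z - g z) = 0

end Geometry

end FlatPhaseSpace

end

/-!
The exponential map of the phase space at `o` is a surjective local biholomorphism, so that a
function on `P` is holomorphic if and only if its pull-back to the tangent space is entire
(`holomorphic_iff`). The space `𝓑_P` is thus identified with the entire, Gaussian square integrable
functions which are constant on the fibres of `exp_o`, and the theorem becomes one on reproducing
kernels of a closed subspace of the Segal-Bargmann space.

On the geometric side, the transition map of two flat charts of `Q` has orthogonal derivatives; it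
therefore preserves distances locally and is an affine isometry
(`exists_linearIsometryEquiv_of_isometric_deriv`, `IsFlatChart.exists_transition`). Geodesic
completeness gives a map `F : ℝⁿ → Q`, the exponential map of `Q`, which is an affine isometry near
every point in suitable flat charts (`exists_baseExp`); there a continuity argument along rays uses
unique continuation of straight lines (`AffineAtlas.eventuallyEq_of_isStraightAt`). The lift
`u + i v ↦ ⟨c + v, (dF_u)⁻¹ ·⟩` of `F` to `P` is locally affine over `ℂ` in the cotangent charts
because orthogonal maps are their own inverse transposes (`exists_phaseLift_affine`), and it sends
real lines to geodesics of `P`. By uniqueness of geodesics it is `exp_o`, up to a complex linear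
change of coordinates (`exists_expMap_eventually_eq`).

On the analytic side, the mean value property on circles, averaged over a polydisc, bounds an entire
function and its derivative locally uniformly by the Gaussian `L²` norm
(`exists_norm_le_gaussNorm`). Hence a space of square integrable entire functions which is closed
under pointwise limits is closed in `L²` (`isClosed_range_toL2`), its evaluations are represented by
elements of the space (`exists_kernel`), and Parseval's identity expands the kernel in any
orthonormal basis (`hasSum_kernel`). This applies to the Segal-Bargmann space and to the space of
pull-backs; the statement on the projection holds because both kernels represent the same
evaluations on the smaller space.
-/

namespace FlatPhaseSpace

/-! ### Local isometries of Euclidean space are affine -/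

/-- A map whose derivatives near `x₀` are isometric is `1`-Lipschitz near `x₀`. -/
theorem eventually_norm_sub_le {V : Type*} [NormedAddCommGroup V] [NormedSpace ℝ V]
    {f : V → V} {f' : V → V →L[ℝ] V} {x₀ : V} (hf : ∀ᶠ x in 𝓝 x₀, HasFDerivAt f (f' x) x)
    (hf' : ∀ᶠ x in 𝓝 x₀, ∀ v, ‖f' x v‖ = ‖v‖) :
    ∃ r > 0, ∀ x ∈ Metric.ball x₀ r, ∀ y ∈ Metric.ball x₀ r, ‖f y - f x‖ ≤ ‖y - x‖ := by
  obtain ⟨r, hr, h⟩ := Metric.eventually_nhds_iff_ball.1 (hf.and hf')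
  refine ⟨r, hr, fun x hx y hy => ?_⟩
  have := (convex_ball x₀ r).norm_image_sub_le_of_norm_hasFDerivWithin_le (f := f) (f' := f')
    (C := 1) (fun z hz => (h z hz).1.hasFDerivWithinAt)
    (fun z hz => ContinuousLinearMap.opNorm_le_bound _ zero_le_one
      (fun v => by rw [(h z hz).2 v, one_mul])) hx hy
  simpa using this

/-- A distance preserving map preserves inner products of differences; differentiating this in one
of the two points shows that the map agrees with its derivative. -/
theorem exists_linearIsometryEquiv_of_isometric_deriv {V : Type*} [NormedAddCommGroup V]
    [InnerProductSpace ℝ V] [FiniteDimensional ℝ V]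
    {f g : V → V} {f' g' : V → V →L[ℝ] V} {x₀ : V}
    (hf : ∀ᶠ x in 𝓝 x₀, HasFDerivAt f (f' x) x)
    (hf' : ∀ᶠ x in 𝓝 x₀, ∀ v, ‖f' x v‖ = ‖v‖)
    (hg : ∀ᶠ x in 𝓝 (f x₀), HasFDerivAt g (g' x) x)
    (hg' : ∀ᶠ x in 𝓝 (f x₀), ∀ v, ‖g' x v‖ = ‖v‖)
    (hgf : ∀ᶠ x in 𝓝 x₀, g (f x) = x) :
    ∃ L : V ≃ₗᵢ[ℝ] V, ∀ᶠ x in 𝓝 x₀, f x = f x₀ + L (x - x₀) ∧ f' x = L := by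
  obtain ⟨r₁, hr₁, h₁⟩ := eventually_norm_sub_le hf hf'
  obtain ⟨r₂, hr₂, h₂⟩ := eventually_norm_sub_le hg hg'
  have hcont : ContinuousAt f x₀ := hf.self_of_nhds.continuousAt
  have hev : ∀ᶠ x in 𝓝 x₀, x ∈ Metric.ball x₀ r₁ ∧ f x ∈ Metric.ball (f x₀) r₂ ∧ g (f x) = x :=
    (Metric.isOpen_ball.eventually_mem (Metric.mem_ball_self hr₁)).and
      ((hcont.eventually_mem (Metric.ball_mem_nhds _ hr₂)).and hgf)
  have hdist : ∀ x y, (x ∈ Metric.ball x₀ r₁ ∧ f x ∈ Metric.ball (f x₀) r₂ ∧ g (f x) = x) →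
      (y ∈ Metric.ball x₀ r₁ ∧ f y ∈ Metric.ball (f x₀) r₂ ∧ g (f y) = y) →
      ‖f x - f y‖ = ‖x - y‖ := by
    intro x y hx hy
    refine le_antisymm (h₁ y hy.1 x hx.1) ?_
    have := h₂ _ hy.2.1 _ hx.2.1
    rwa [hx.2.2, hy.2.2] at this
  have hinner : ∀ x y, (x ∈ Metric.ball x₀ r₁ ∧ f x ∈ Metric.ball (f x₀) r₂ ∧ g (f x) = x) →
      (y ∈ Metric.ball x₀ r₁ ∧ f y ∈ Metric.ball (f x₀) r₂ ∧ g (f y) = y) →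
      inner ℝ (f x - f x₀) (f y - f x₀) = inner ℝ (x - x₀) (y - x₀) := by
    intro x y hx hy
    have h0 := hev.self_of_nhds
    rw [real_inner_eq_norm_mul_self_add_norm_mul_self_sub_norm_sub_mul_self_div_two,
      real_inner_eq_norm_mul_self_add_norm_mul_self_sub_norm_sub_mul_self_div_two,
      sub_sub_sub_cancel_right, sub_sub_sub_cancel_right, hdist x x₀ hx h0, hdist y x₀ hy h0,
      hdist x y hx hy]
  let L₀ : V →ₗᵢ[ℝ] V := ⟨(f' x₀ : V →ₗ[ℝ] V), hf'.self_of_nhds⟩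
  let L : V ≃ₗᵢ[ℝ] V := L₀.toLinearIsometryEquiv rfl
  have hL : ∀ v, L v = f' x₀ v := fun v => rfl
  have key : ∀ᶠ x in 𝓝 x₀, f x = f x₀ + L (x - x₀) := by
    filter_upwards [hev] with x hx
    have hline : ∀ v : V, inner ℝ (f x - f x₀) (L v) = inner ℝ (x - x₀) v := by
      intro v
      have hc : HasDerivAt (fun t : ℝ => x₀ + t • v) v 0 := by
        simpa using ((hasDerivAt_id (0 : ℝ)).smul_const v).const_add x₀
      have hfx : HasFDerivAt f (f' x₀) (x₀ + (0 : ℝ) • v) := by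
        simpa using hf.self_of_nhds
      have hd := hfx.comp_hasDerivAt (0 : ℝ) hc
      have h1 : HasDerivAt (fun t : ℝ => inner ℝ (f x - f x₀) (f (x₀ + t • v) - f x₀))
          (inner ℝ (f x - f x₀) (f' x₀ v)) 0 := by
        simpa using (hasDerivAt_const (0 : ℝ) (f x - f x₀)).inner ℝ (hd.sub_const (f x₀))
      have h2 : HasDerivAt (fun t : ℝ => inner ℝ (x - x₀) ((x₀ + t • v) - x₀))
          (inner ℝ (x - x₀) v) 0 := by
        simpa using (hasDerivAt_const (0 : ℝ) (x - x₀)).inner ℝ (hc.sub_const x₀)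
      have hc0 : Tendsto (fun t : ℝ => x₀ + t • v) (𝓝 0) (𝓝 x₀) := by
        simpa using hc.continuousAt.tendsto
      have heq : (fun t : ℝ => inner ℝ (f x - f x₀) (f (x₀ + t • v) - f x₀)) =ᶠ[𝓝 0]
          (fun t : ℝ => inner ℝ (x - x₀) ((x₀ + t • v) - x₀)) := by
        filter_upwards [hc0.eventually hev] with t ht
        exact hinner x _ hx ht
      rw [hL]
      exact h1.unique (h2.congr_of_eventuallyEq heq)
    have hz : ∀ v, inner ℝ (f x - f x₀ - L (x - x₀)) (L v) = 0 := by
      intro v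
      rw [inner_sub_left, hline, L.inner_map_map, sub_self]
    have := hz (L.symm (f x - f x₀ - L (x - x₀)))
    rw [L.apply_symm_apply, inner_self_eq_zero, sub_eq_zero] at this
    rw [← this]; abel
  refine ⟨L, ?_⟩
  filter_upwards [key, key.eventually_nhds, hf] with x hx hx' hfx
  refine ⟨hx, ?_⟩
  have h3 : HasFDerivAt (fun y => f x₀ + L (y - x₀)) (L : V →L[ℝ] V) x := by
    have := (L : V →L[ℝ] V).hasFDerivAt (x := x - x₀)
    simpa using (this.comp x ((hasFDerivAt_id x).sub_const x₀)).const_add (f x₀)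
  exact hfx.unique (h3.congr_of_eventuallyEq hx')

/-! ### Transition maps of flat charts -/

section Charts

variable {n : ℕ} {Q : Type*} [TopologicalSpace Q] [ChartedSpace (Euc n) Q]
  [RiemannianBundle (fun q : Q => TQ (n := n) q)] {κ κ' : OpenPartialHomeomorph Q (Euc n)}

theorem IsFlatChart.mdifferentiableAt (hκ : IsFlatChart κ) {q : Q} (hq : q ∈ κ.source) :
    MDifferentiableAt 𝓘(ℝ, Euc n) 𝓘(ℝ, Euc n) κ q :=
  (contMDiffAt_of_mem_maximalAtlas hκ.smooth hq).mdifferentiableAt (by simp)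

theorem IsFlatChart.mdifferentiableAt_symm (hκ : IsFlatChart κ) {x : Euc n} (hx : x ∈ κ.target) :
    MDifferentiableAt 𝓘(ℝ, Euc n) 𝓘(ℝ, Euc n) κ.symm x :=
  (contMDiffAt_symm_of_mem_maximalAtlas hκ.smooth hx).mdifferentiableAt (by simp)

theorem IsFlatChart.norm_chartDeriv (hκ : IsFlatChart κ) {q : Q} (hq : q ∈ κ.source)
    (v : TQ (n := n) q) : ‖chartDeriv κ q v‖ ^ 2 = inner ℝ v v := by
  rw [← hκ.isometric q hq v v, real_inner_self_eq_norm_sq]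

theorem IsFlatChart.chartDeriv_injective (hκ : IsFlatChart κ) {q : Q} (hq : q ∈ κ.source) :
    Function.Injective (chartDeriv κ q) := by
  refine (injective_iff_map_eq_zero _).2 fun v hv => ?_
  have := hκ.norm_chartDeriv hq v
  rw [hv, norm_zero] at this
  exact inner_self_eq_zero.1 (by rw [← this]; norm_num)

theorem IsFlatChart.chartDeriv_bijective (hκ : IsFlatChart κ) {q : Q} (hq : q ∈ κ.source) :
    Function.Bijective (chartDeriv κ q) := by
  have h := hκ.chartDeriv_injective hq
  -- the tangent space at `q` is `ℝⁿ` by definition, with a different norm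
  let D : Euc n →L[ℝ] Euc n := chartDeriv κ q
  exact ⟨h, LinearMap.surjective_of_injective (f := D.toLinearMap) h⟩

theorem IsFlatChart.transition_hasFDerivAt (hκ : IsFlatChart κ) (hκ' : IsFlatChart κ') {q : Q}
    (hq : q ∈ κ.source) (hq' : q ∈ κ'.source) :
    HasFDerivAt (fun x => κ' (κ.symm x)) (fderiv ℝ (fun x => κ' (κ.symm x)) (κ q)) (κ q) ∧
    ∀ v, fderiv ℝ (fun x => κ' (κ.symm x)) (κ q) (chartDeriv κ q v) = chartDeriv κ' q v := by
  have h1 : MDifferentiableAt 𝓘(ℝ, Euc n) 𝓘(ℝ, Euc n) (fun x => κ' (κ.symm x)) (κ q) := by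
    refine MDifferentiableAt.comp (κ q) (g := κ') (I' := 𝓘(ℝ, Euc n)) ?_
      (hκ.mdifferentiableAt_symm (κ.map_source hq))
    rw [κ.left_inv hq]
    exact hκ'.mdifferentiableAt hq'
  refine ⟨h1.differentiableAt.hasFDerivAt, fun v => ?_⟩
  have h2 : mfderiv 𝓘(ℝ, Euc n) 𝓘(ℝ, Euc n) κ' q =
      mfderiv 𝓘(ℝ, Euc n) 𝓘(ℝ, Euc n) ((fun x => κ' (κ.symm x)) ∘ κ) q := by
    refine Filter.EventuallyEq.mfderiv_eq ?_
    filter_upwards [κ.open_source.mem_nhds hq] with p hp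
    simp [κ.left_inv hp]
  rw [mfderiv_comp q h1 (hκ.mdifferentiableAt hq), mfderiv_eq_fderiv] at h2
  exact (DFunLike.congr_fun h2 v).symm

/-- The transition maps of flat charts have orthogonal derivatives, hence are locally affine
isometries, with the same linear part relating the differentials of the charts. -/
theorem IsFlatChart.exists_transition (hκ : IsFlatChart κ) (hκ' : IsFlatChart κ') {q : Q}
    (hq : q ∈ κ.source) (hq' : q ∈ κ'.source) :
    ∃ L : Euc n ≃ₗᵢ[ℝ] Euc n, ∀ᶠ x in 𝓝 (κ q), x ∈ κ.target ∧ κ.symm x ∈ κ'.source ∧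
      κ' (κ.symm x) = κ' q + L (x - κ q) ∧
      ∀ v, chartDeriv κ' (κ.symm x) v = L (chartDeriv κ (κ.symm x) v) := by
  have hdom : ∀ {κ κ' : OpenPartialHomeomorph Q (Euc n)}, q ∈ κ.source → q ∈ κ'.source →
      ∀ᶠ x in 𝓝 (κ q), x ∈ κ.target ∧ κ.symm x ∈ κ'.source := by
    intro κ κ' hq hq'
    refine (κ.open_target.eventually_mem (κ.map_source hq)).and ?_
    have := κ.continuousAt_symm (κ.map_source hq)
    refine this.eventually_mem (κ'.open_source.mem_nhds ?_)
    rwa [κ.left_inv hq]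
  have hder : ∀ {κ κ' : OpenPartialHomeomorph Q (Euc n)}, IsFlatChart κ → IsFlatChart κ' →
      q ∈ κ.source → q ∈ κ'.source →
      (∀ᶠ x in 𝓝 (κ q), HasFDerivAt (fun x => κ' (κ.symm x))
        (fderiv ℝ (fun x => κ' (κ.symm x)) x) x) ∧
      (∀ᶠ x in 𝓝 (κ q), ∀ v, ‖fderiv ℝ (fun x => κ' (κ.symm x)) x v‖ = ‖v‖) ∧
      (∀ᶠ x in 𝓝 (κ q), ∀ v, fderiv ℝ (fun x => κ' (κ.symm x)) x
        (chartDeriv κ (κ.symm x) v) = chartDeriv κ' (κ.symm x) v) := by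
    intro κ κ' hκ hκ' hq hq'
    refine ⟨?_, ?_, ?_⟩ <;> filter_upwards [hdom hq hq'] with x hx
    · have := (hκ.transition_hasFDerivAt hκ' (κ.map_target hx.1) hx.2).1
      rwa [κ.right_inv hx.1] at this
    · intro v
      obtain ⟨w, rfl⟩ := (hκ.chartDeriv_bijective (κ.map_target hx.1)).2 v
      have := (hκ.transition_hasFDerivAt hκ' (κ.map_target hx.1) hx.2).2 w
      rw [κ.right_inv hx.1] at this
      rw [this]
      refine (sq_eq_sq₀ (norm_nonneg _) (norm_nonneg _)).1 ?_
      rw [hκ'.norm_chartDeriv hx.2, hκ.norm_chartDeriv (κ.map_target hx.1)]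
    · intro v
      have := (hκ.transition_hasFDerivAt hκ' (κ.map_target hx.1) hx.2).2 v
      rwa [κ.right_inv hx.1] at this
  obtain ⟨h1, h2, h3⟩ := hder hκ hκ' hq hq'
  obtain ⟨h1', h2', -⟩ := hder hκ' hκ hq' hq
  have hq0 : κ' q = (fun x => κ' (κ.symm x)) (κ q) := by simp [κ.left_inv hq]
  rw [hq0] at h1' h2'
  obtain ⟨L, hL⟩ := exists_linearIsometryEquiv_of_isometric_deriv h1 h2 h1' h2' (by
    filter_upwards [hdom hq hq'] with x hx
    rw [κ'.left_inv hx.2, κ.right_inv hx.1])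
  refine ⟨L, ?_⟩
  filter_upwards [hdom hq hq', hL, h3] with x hx hLx h3x
  refine ⟨hx.1, hx.2, by rw [hq0, ← hLx.1], fun v => ?_⟩
  rw [← h3x, hLx.2]
  rfl

end Charts

/-! ### Complex coordinates on the cotangent bundle -/

/-- The vector `x + i y` of `ℂⁿ`. -/
def toComplex {n : ℕ} (x y : Euc n) : Fin n → ℂ := fun k => ⟨x k, y k⟩

section Complexify

variable {n : ℕ}

@[simp]
theorem rePart_toComplex (x y : Euc n) : rePart (toComplex x y) = x := rfl

@[simp]
theorem imPart_toComplex (x y : Euc n) : imPart (toComplex x y) = y := rfl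

@[simp]
theorem toComplex_rePart_imPart (z : Fin n → ℂ) : toComplex (rePart z) (imPart z) = z := rfl

theorem toComplex_add (x y x' y' : Euc n) :
    toComplex x y + toComplex x' y' = toComplex (x + x') (y + y') := rfl

@[simp]
theorem rePart_add (z w : Fin n → ℂ) : rePart (z + w) = rePart z + rePart w := rfl

@[simp]
theorem imPart_add (z w : Fin n → ℂ) : imPart (z + w) = imPart z + imPart w := rfl

@[simp]
theorem rePart_sub (z w : Fin n → ℂ) : rePart (z - w) = rePart z - rePart w := rfl

@[simp]
theorem imPart_sub (z w : Fin n → ℂ) : imPart (z - w) = imPart z - imPart w := rfl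

theorem rePart_smul (c : ℂ) (z : Fin n → ℂ) :
    rePart (c • z) = c.re • rePart z - c.im • imPart z := by
  ext k; simp [rePart, imPart]

theorem imPart_smul (c : ℂ) (z : Fin n → ℂ) :
    imPart (c • z) = c.re • imPart z + c.im • rePart z := by
  ext k; simp [rePart, imPart]

theorem continuous_rePart : Continuous (rePart (n := n)) := by
  unfold rePart
  fun_prop

theorem isOpen_cotangentDomain {Q : Type*} [TopologicalSpace Q]
    (κ : OpenPartialHomeomorph Q (Euc n)) : IsOpen (cotangentDomain κ) :=
  κ.open_target.preimage continuous_rePart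

/-- The complex linear extension to `ℂⁿ` of a linear automorphism of `ℝⁿ`. -/
noncomputable def complexify (L : Euc n ≃ₗ[ℝ] Euc n) : (Fin n → ℂ) ≃L[ℂ] (Fin n → ℂ) :=
  LinearEquiv.toContinuousLinearEquiv
    { toFun := fun z => toComplex (L (rePart z)) (L (imPart z))
      invFun := fun z => toComplex (L.symm (rePart z)) (L.symm (imPart z))
      map_add' := fun z w => by simp [toComplex_add]
      map_smul' := fun c z => by
        simp only [rePart_smul, imPart_smul, map_add, map_sub, map_smul, RingHom.id_apply]
        ext k
        simp [toComplex, Complex.ext_iff]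
      left_inv := fun z => by simp
      right_inv := fun z => by simp }

theorem complexify_apply (L : Euc n ≃ₗ[ℝ] Euc n) (z : Fin n → ℂ) :
    complexify L z = toComplex (L (rePart z)) (L (imPart z)) := rfl

end Complexify

section Phase

variable {n : ℕ} {Q : Type*} [TopologicalSpace Q] [ChartedSpace (Euc n) Q]
  {κ κ' : OpenPartialHomeomorph Q (Euc n)}

theorem cotangentParam_toComplex (κ : OpenPartialHomeomorph Q (Euc n)) (x y : Euc n) :
    cotangentParam κ (toComplex x y) =
      ⟨κ.symm x, (innerSL ℝ y).comp (chartDeriv κ (κ.symm x))⟩ := rfl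

theorem phase_ext {q q' : Q} (h : q = q') {p : TQ (n := n) q →L[ℝ] ℝ} {p' : TQ (n := n) q' →L[ℝ] ℝ}
    (hp : ∀ v : Euc n, p v = p' v) : (⟨q, p⟩ : Phase n Q) = ⟨q', p'⟩ := by
  subst h
  congr 1
  ext v
  exact hp v

/-- If the transition map from the flat chart `κ` to the flat chart `κ'` is an affine isometry with
linear part `L`, then `L` also relates the momenta, because it is its own inverse transpose. -/
theorem cotangentParam_eq_of_transition {L : Euc n ≃ₗᵢ[ℝ] Euc n} {x x' : Euc n}
    (h : κ.symm x = κ'.symm x')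
    (hd : ∀ v, chartDeriv κ' (κ.symm x) v = L (chartDeriv κ (κ.symm x) v)) (y : Euc n) :
    cotangentParam κ (toComplex x y) = cotangentParam κ' (toComplex x' (L y)) := by
  rw [cotangentParam_toComplex, cotangentParam_toComplex, ← h]
  refine phase_ext rfl fun v => ?_
  change inner ℝ y (chartDeriv κ (κ.symm x) v) = inner ℝ (L y) (chartDeriv κ' (κ.symm x) v)
  rw [hd v, L.inner_map_map]

theorem velocity_eq (κ : OpenPartialHomeomorph Q (Euc n)) {q : Q}
    (b : Module.Basis (Fin n) ℝ (TQ (n := n) q)) (z : Fin n → ℂ) :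
    velocity κ b z = toComplex (chartDeriv κ q (∑ i, (z i).re • b i))
      (chartDeriv κ q (∑ i, (z i).im • b i)) := by
  ext k
  simp [velocity, toComplex, Complex.ext_iff]

variable [RiemannianBundle (fun q : Q => TQ (n := n) q)]

theorem cotangentParam_injOn (hκ : IsFlatChart κ) :
    InjOn (cotangentParam κ) (cotangentDomain κ) := by
  intro z hz w hw h
  have hq : κ.symm (rePart z) = κ.symm (rePart w) := congrArg TotalSpace.proj h
  have hre : rePart z = rePart w := κ.symm.injOn hz hw hq
  have him : imPart z = imPart w := by
    rw [← toComplex_rePart_imPart z, ← toComplex_rePart_imPart w, cotangentParam_toComplex,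
      cotangentParam_toComplex, hre] at h
    have h2 := eq_of_heq (TotalSpace.mk.inj h).2
    refine ext_inner_right ℝ fun v => ?_
    obtain ⟨u, rfl⟩ := (hκ.chartDeriv_bijective (κ.map_target hw)).2 v
    exact DFunLike.congr_fun h2 u
  rw [← toComplex_rePart_imPart z, ← toComplex_rePart_imPart w, hre, him]

end Phase

/-! ### Straight curves in affinely parametrized spaces -/

/-- A family of local parametrizations of `M` by open subsets of a normed space `V`, which are
injective, have locally affine transition maps, and separate the points of `M`. It stands for a
Hausdorff affine manifold; no topology on `M` is needed. -/
structure AffineAtlas (ι V M : Type*) [NormedAddCommGroup V] [NormedSpace ℝ V] where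
  /-- The domain of a parametrization. -/
  dom : ι → Set V
  /-- The parametrizations. -/
  param : ι → V → M
  isOpen_dom : ∀ i, IsOpen (dom i)
  injOn : ∀ i, InjOn (param i) (dom i)
  transition : ∀ i j x y, x ∈ dom i → y ∈ dom j → param i x = param j y →
    ∃ L : V →L[ℝ] V, ∀ᶠ x' in 𝓝 x, param i x' = param j (y + L (x' - x))
  separated : ∀ i j x y, x ∈ dom i → y ∈ dom j → param i x ≠ param j y →
    ∀ᶠ p in 𝓝 x ×ˢ 𝓝 y, param i p.1 ≠ param j p.2

namespace AffineAtlas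

variable {ι V M : Type*} [NormedAddCommGroup V] [NormedSpace ℝ V] (A : AffineAtlas ι V M)

/-- The curve `γ` is a straight line, near time `t₀`, in some parametrization. -/
def IsStraightAt (γ : ℝ → M) (t₀ : ℝ) : Prop :=
  ∃ (i : ι) (x v : V), x ∈ A.dom i ∧ ∀ᶠ t in 𝓝 t₀, γ t = A.param i (x + (t - t₀) • v)

theorem isStraightAt_line {i : ι} {x v : V} {t₀ : ℝ} (h : x + t₀ • v ∈ A.dom i) :
    A.IsStraightAt (fun t => A.param i (x + t • v)) t₀ :=
  ⟨i, x + t₀ • v, v, h, Eventually.of_forall fun t => by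
    simp only [sub_smul]
    abel_nf⟩

theorem IsStraightAt.comp_mul {γ : ℝ → M} {c t₀ : ℝ} (h : A.IsStraightAt γ (c * t₀)) :
    A.IsStraightAt (fun t => γ (c * t)) t₀ := by
  obtain ⟨i, x, v, hx, hγ⟩ := h
  refine ⟨i, x, c • v, hx, ?_⟩
  have hc : Tendsto (fun t : ℝ => c * t) (𝓝 t₀) (𝓝 (c * t₀)) := tendsto_id.const_mul c
  filter_upwards [hc.eventually hγ] with t ht
  rw [ht, smul_smul]
  congr 3
  ring

theorem tendsto_line (x v : V) (t₀ : ℝ) :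
    Tendsto (fun t : ℝ => x + (t - t₀) • v) (𝓝 t₀) (𝓝 x) := by
  have : Continuous (fun t : ℝ => x + (t - t₀) • v) := by fun_prop
  simpa using this.tendsto t₀

/-- Unique continuation of straight curves. -/
theorem eventuallyEq_of_isStraightAt {s : Set ℝ} (hs : IsPreconnected s) {γ₁ γ₂ : ℝ → M}
    (h₁ : ∀ t ∈ s, A.IsStraightAt γ₁ t) (h₂ : ∀ t ∈ s, A.IsStraightAt γ₂ t) {t₀ : ℝ}
    (ht₀ : t₀ ∈ s) (h₀ : γ₁ =ᶠ[𝓝 t₀] γ₂) : ∀ t ∈ s, γ₁ =ᶠ[𝓝 t] γ₂ := by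
  have hopen : IsOpen {t | γ₁ =ᶠ[𝓝 t] γ₂} := isOpen_setOfPred_eventually_nhds
  refine hs.subset_of_closure_inter_subset hopen ⟨t₀, ht₀, h₀⟩ ?_
  rintro t ⟨htc, hts⟩
  obtain ⟨i, x, v, hx, hγ₁⟩ := h₁ t hts
  obtain ⟨j, y, w, hy, hγ₂⟩ := h₂ t hts
  have hfreq : ∃ᶠ t' in 𝓝 t, γ₁ =ᶠ[𝓝 t'] γ₂ := mem_closure_iff_frequently.1 htc
  have hxy : A.param i x = A.param j y := by
    by_contra hne
    have hp : Tendsto (fun t' : ℝ => (x + (t' - t) • v, y + (t' - t) • w)) (𝓝 t)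
        (𝓝 x ×ˢ 𝓝 y) := (tendsto_line x v t).prodMk (tendsto_line y w t)
    refine hfreq (((hp.eventually (A.separated i j x y hx hy hne)).and (hγ₁.and hγ₂)).mono ?_)
    rintro t' ⟨hne', h1, h2⟩ heq
    exact hne' (by rw [← h1, ← h2]; exact heq.self_of_nhds)
  obtain ⟨L, hL⟩ := A.transition i j x y hx hy hxy
  have hγ₁' : ∀ᶠ t' in 𝓝 t, γ₁ t' = A.param j (y + (t' - t) • L v) := by
    filter_upwards [hγ₁, (tendsto_line x v t).eventually hL] with t' h1 h2
    rw [h1, h2]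
    simp
  have hd : ∀ u : V, ∀ᶠ t' in 𝓝 t, y + (t' - t) • u ∈ A.dom j := fun u =>
    (tendsto_line y u t).eventually_mem ((A.isOpen_dom j).mem_nhds hy)
  obtain ⟨t', heq, h'⟩ := (hfreq.and_eventually
    ((hγ₁'.and (hγ₂.and ((hd (L v)).and (hd w)))).eventually_nhds)).exists
  have hvw : L v = w := by
    have hall : ∀ᶠ τ in 𝓝[≠] t', (τ - t) • L v = (τ - t) • w ∧ τ ≠ t' := by
      refine ((heq.and h').filter_mono nhdsWithin_le_nhds).and self_mem_nhdsWithin |>.mono ?_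
      rintro τ ⟨⟨h, h1, h2, h3, h4⟩, hne⟩
      refine ⟨?_, hne⟩
      rw [h1, h2] at h
      exact add_left_cancel (A.injOn j h3 h4 h)
    -- the two affine curves agree at `t'` and at a nearby time `τ ≠ t'`
    have heq' : (t' - t) • L v = (t' - t) • w := by
      obtain ⟨h1, h2, h3, h4⟩ := h'.self_of_nhds
      have h := heq.self_of_nhds
      rw [h1, h2] at h
      exact add_left_cancel (A.injOn j h3 h4 h)
    obtain ⟨τ, hτ, hne⟩ := hall.exists
    have : (τ - t') • L v = (τ - t') • w := by
      have := congrArg₂ (· - ·) hτ heq'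
      simpa [← sub_smul] using this
    exact smul_right_injective V (sub_ne_zero.2 hne) this
  change γ₁ =ᶠ[𝓝 t] γ₂
  filter_upwards [hγ₁', hγ₂] with τ h1 h2
  rw [h1, h2, hvw]

end AffineAtlas

/-! ### The exponential map of the configuration manifold -/

section Base

variable {n : ℕ} {Q : Type*} [TopologicalSpace Q] [ChartedSpace (Euc n) Q]
  [RiemannianBundle (fun q : Q => TQ (n := n) q)]

theorem IsFlatChart.exists_symm_transition {κ κ' : OpenPartialHomeomorph Q (Euc n)}
    (hκ : IsFlatChart κ) (hκ' : IsFlatChart κ') {x y : Euc n} (hx : x ∈ κ.target)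
    (hy : y ∈ κ'.target) (h : κ.symm x = κ'.symm y) :
    ∃ L : Euc n ≃ₗᵢ[ℝ] Euc n, ∀ᶠ x' in 𝓝 x, κ.symm x' = κ'.symm (y + L (x' - x)) ∧
      ∀ v, chartDeriv κ' (κ.symm x') v = L (chartDeriv κ (κ.symm x') v) := by
  have hq' : κ.symm x ∈ κ'.source := by rw [h]; exact κ'.map_target hy
  obtain ⟨L, hL⟩ := hκ.exists_transition hκ' (κ.map_target hx) hq'
  rw [κ.right_inv hx] at hL
  refine ⟨L, hL.mono ?_⟩
  rintro x' ⟨-, h2, h3, h4⟩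
  rw [h, κ'.right_inv hy] at h3
  exact ⟨by rw [← h3, κ'.left_inv h2], h4⟩

variable (n Q) in
/-- The affine structure of the configuration manifold. -/
def baseAtlas [T2Space Q] :
    AffineAtlas {κ : OpenPartialHomeomorph Q (Euc n) // IsFlatChart κ} (Euc n) Q where
  dom κ := κ.1.target
  param κ := κ.1.symm
  isOpen_dom κ := κ.1.open_target
  injOn κ := κ.1.symm.injOn
  transition κ κ' x y hx hy h := by
    obtain ⟨L, hL⟩ := κ.2.exists_symm_transition κ'.2 hx hy h
    exact ⟨(L : Euc n →L[ℝ] Euc n), hL.mono fun x' hx' => hx'.1⟩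
  separated κ κ' x y hx hy h := by
    have h1 : Tendsto (fun p : Euc n × Euc n => (κ.1.symm p.1, κ'.1.symm p.2)) (𝓝 x ×ˢ 𝓝 y)
        (𝓝 (κ.1.symm x) ×ˢ 𝓝 (κ'.1.symm y)) :=
      (κ.1.continuousAt_symm hx).tendsto.prodMap (κ'.1.continuousAt_symm hy).tendsto
    rw [← nhds_prod_eq (x := κ.1.symm x)] at h1
    exact h1.eventually_mem ((isClosed_diagonal (X := Q)).isOpen_compl.mem_nhds
      (show (κ.1.symm x, κ'.1.symm y) ∈ (diagonal Q)ᶜ from h))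

/-- The map `F` is near `u` an affine isometry in some flat chart. -/
def IsAffineAt (F : Euc n → Q) (u : Euc n) : Prop :=
  ∃ (κ : OpenPartialHomeomorph Q (Euc n)) (x : Euc n) (L : Euc n ≃ₗᵢ[ℝ] Euc n),
    IsFlatChart κ ∧ x ∈ κ.target ∧ ∀ᶠ u' in 𝓝 u, F u' = κ.symm (x + L (u' - u))

theorem tendsto_affine {V : Type*} [NormedAddCommGroup V] [NormedSpace ℝ V] (x u : V)
    (L : V → V) (hL : Continuous L) (hL0 : L 0 = 0) :
    Tendsto (fun u' => x + L (u' - u)) (𝓝 u) (𝓝 x) := by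
  have : Continuous (fun u' => x + L (u' - u)) := by fun_prop
  simpa [hL0] using this.tendsto u

/-- A map which is locally affine in some flat chart is so in all flat charts. -/
theorem IsAffineAt.exists_eventually_eq {F : Euc n → Q} {u : Euc n} (h : IsAffineAt F u)
    {κ' : OpenPartialHomeomorph Q (Euc n)} (hκ' : IsFlatChart κ') {y : Euc n}
    (hy : y ∈ κ'.target) (hF : F u = κ'.symm y) :
    ∃ L : Euc n ≃ₗᵢ[ℝ] Euc n, ∀ᶠ u' in 𝓝 u, F u' = κ'.symm (y + L (u' - u)) := by
  obtain ⟨κ, x, L, hκ, hx, hL⟩ := h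
  have hxy : κ.symm x = κ'.symm y := by rw [← hF, hL.self_of_nhds]; simp
  obtain ⟨R, hR⟩ := hκ.exists_symm_transition hκ' hx hy hxy
  refine ⟨L.trans R, ?_⟩
  filter_upwards [hL, (tendsto_affine x u L L.continuous (map_zero L)).eventually hR]
    with u' h1 h2
  rw [h1, h2.1]
  simp

theorem IsAffineAt.eventually {F : Euc n → Q} {u : Euc n} (h : IsAffineAt F u) :
    ∀ᶠ u' in 𝓝 u, IsAffineAt F u' := by
  obtain ⟨κ, x, L, hκ, hx, hL⟩ := h
  filter_upwards [hL.eventually_nhds, (tendsto_affine x u L L.continuous (map_zero L)).eventually_mem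
    (κ.open_target.mem_nhds hx)] with u' h1 h2
  refine ⟨κ, _, L, hκ, h2, h1.mono fun u'' h3 => ?_⟩
  rw [h3, add_assoc, ← map_add]
  congr 3
  abel

/-- Geodesic completeness yields geodesics with any initial velocity in a given flat chart. -/
theorem exists_geodesic_of_chart (hcomplete : GeodesicallyComplete n Q)
    {κ₀ : OpenPartialHomeomorph Q (Euc n)} (hκ₀ : IsFlatChart κ₀) {x₀ : Euc n}
    (hx₀ : x₀ ∈ κ₀.target) (u : Euc n) :
    ∃ γ : ℝ → Q, IsGeodesicBase (n := n) γ ∧ ∀ᶠ t : ℝ in 𝓝 0, γ t = κ₀.symm (x₀ + t • u) := by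
  have hq₀ := κ₀.map_target hx₀
  obtain ⟨v, hv⟩ := (hκ₀.chartDeriv_bijective hq₀).2 u
  obtain ⟨γ, hγ, hγ0, κ, hκ, hq, hder⟩ := hcomplete (κ₀.symm x₀) v
  refine ⟨γ, hγ, ?_⟩
  obtain ⟨κ', x, w, hκ', hx, hline⟩ := hγ 0
  have hx0 : κ'.symm x = κ₀.symm x₀ := by
    rw [← hγ0, hline.self_of_nhds]; simp
  -- in the chart `κ` the derivative of the straight line at `0` is known
  have hxκ : κ'.symm x = κ.symm (κ (κ₀.symm x₀)) := by rw [hx0, κ.left_inv hq]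
  obtain ⟨L, hL⟩ := hκ'.exists_symm_transition hκ hx (κ.map_source hq) hxκ
  have ht := AffineAtlas.tendsto_line x w 0
  have h1 : ∀ᶠ t in 𝓝 (0 : ℝ), γ t = κ.symm (κ (κ₀.symm x₀) + t • L w) := by
    filter_upwards [hline, ht.eventually hL] with t h1 h2
    rw [h1, h2.1]
    simp
  have h2 : (fun t => κ (γ t)) =ᶠ[𝓝 0] fun t => κ (κ₀.symm x₀) + t • L w := by
    have h3 : ∀ᶠ t : ℝ in 𝓝 0, κ (κ₀.symm x₀) + t • L w ∈ κ.target := by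
      have := (AffineAtlas.tendsto_line (κ (κ₀.symm x₀)) (L w) 0).eventually_mem
        (κ.open_target.mem_nhds (κ.map_source hq))
      simpa using this
    filter_upwards [h1, h3] with t h1 h3
    rw [h1, κ.right_inv h3]
  have h3 : HasDerivAt (fun t : ℝ => κ (κ₀.symm x₀) + t • L w) (L w) 0 := by
    simpa using ((hasDerivAt_id (0 : ℝ)).smul_const (L w)).const_add (κ (κ₀.symm x₀))
  have h4 : chartDeriv κ (κ₀.symm x₀) v = L w := hder.unique (h3.congr_of_eventuallyEq h2)
  obtain ⟨R, hR⟩ := hκ.exists_symm_transition hκ₀ (κ.map_source hq) hx₀ (κ.left_inv hq)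
  have h5 : R (L w) = u := by
    have := hR.self_of_nhds.2 v
    rw [κ.left_inv hq, hv, h4] at this
    exact this.symm
  have ht' := AffineAtlas.tendsto_line (κ (κ₀.symm x₀)) (L w) 0
  filter_upwards [h1, ht'.eventually hR] with t h1 h2
  rw [sub_zero] at h2
  rw [h1, h2.1]
  simp [h5]

/-- The exponential map of a geodesically complete flat manifold, in a flat chart at the base
point: it is everywhere a local affine isometry. The set of times at which this holds along a ray
is open, and it is closed since a geodesic close to the ray stays in the same flat chart. -/
theorem exists_baseExp [T2Space Q] (hcomplete : GeodesicallyComplete n Q)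
    {κ₀ : OpenPartialHomeomorph Q (Euc n)} (hκ₀ : IsFlatChart κ₀) {x₀ : Euc n}
    (hx₀ : x₀ ∈ κ₀.target) :
    ∃ F : Euc n → Q, (∀ᶠ u in 𝓝 0, F u = κ₀.symm (x₀ + u)) ∧ ∀ u, IsAffineAt F u := by
  choose γ hγ hγ0 using exists_geodesic_of_chart hcomplete hκ₀ hx₀
  have hstr : ∀ u t, (baseAtlas n Q).IsStraightAt (γ u) t := fun u t => by
    obtain ⟨κ, x, v, hκ, hx, h⟩ := hγ u t
    exact ⟨⟨κ, hκ⟩, x, v, hx, h⟩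
  have hscale : ∀ u t, γ u t = γ (t • u) 1 := by
    intro u t
    have h1 : ∀ s, (baseAtlas n Q).IsStraightAt (fun s => γ u (t * s)) s := fun s =>
      AffineAtlas.IsStraightAt.comp_mul _ (hstr u (t * s))
    have hc : Tendsto (fun s : ℝ => t * s) (𝓝 0) (𝓝 0) := by
      simpa using (tendsto_id (α := ℝ) (x := 𝓝 0)).const_mul t
    have h0 : (fun s => γ u (t * s)) =ᶠ[𝓝 0] γ (t • u) := by
      filter_upwards [hc.eventually (hγ0 u), hγ0 (t • u)] with s h1 h2
      rw [h1, h2, smul_smul, mul_comm]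
    have := (baseAtlas n Q).eventuallyEq_of_isStraightAt isPreconnected_univ (fun s _ => h1 s)
      (fun s _ => hstr (t • u) s) (mem_univ 0) h0 1 (mem_univ _)
    simpa using this.self_of_nhds
  have hline : ∀ {κ : OpenPartialHomeomorph Q (Euc n)} (hκ : IsFlatChart κ) {x w : Euc n} {t : ℝ},
      x + t • w ∈ κ.target → (baseAtlas n Q).IsStraightAt (fun t => κ.symm (x + t • w)) t :=
    fun {κ} hκ {x w t} h => (baseAtlas n Q).isStraightAt_line (i := ⟨κ, hκ⟩) h
  have hnear : ∀ᶠ u in 𝓝 (0 : Euc n), γ u 1 = κ₀.symm (x₀ + u) := by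
    obtain ⟨r, hr, hball⟩ := Metric.isOpen_iff.1 κ₀.open_target x₀ hx₀
    filter_upwards [Metric.ball_mem_nhds 0 hr] with u hu
    have hs : ∀ s ∈ Icc (0 : ℝ) 1, (baseAtlas n Q).IsStraightAt (fun t => κ₀.symm (x₀ + t • u)) s := by
      intro s hs
      refine hline hκ₀ (hball ?_)
      rw [mem_ball_iff_norm, add_sub_cancel_left, norm_smul, Real.norm_of_nonneg hs.1]
      rw [mem_ball_zero_iff] at hu
      nlinarith [hs.2, norm_nonneg u]
    have := (baseAtlas n Q).eventuallyEq_of_isStraightAt isPreconnected_Icc (fun s _ => hstr u s)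
      hs (left_mem_Icc.2 zero_le_one) (hγ0 u) 1 (right_mem_Icc.2 zero_le_one)
    simpa using this.self_of_nhds
  refine ⟨fun u => γ u 1, hnear, fun u => ?_⟩
  have haff0 : IsAffineAt (fun u => γ u 1) (0 : Euc n) :=
    ⟨κ₀, x₀, LinearIsometryEquiv.refl ℝ _, hκ₀, hx₀, by simpa using hnear⟩
  have hopen : IsOpen {t : ℝ | IsAffineAt (fun u => γ u 1) (t • u)} := by
    refine isOpen_iff_eventually.2 fun t ht => ?_
    have hc : Tendsto (fun t : ℝ => t • u) (𝓝 t) (𝓝 (t • u)) := tendsto_id.smul_const u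
    exact hc.eventually ht.eventually
  have hall : univ ⊆ {t : ℝ | IsAffineAt (fun u => γ u 1) (t • u)} := by
    refine isPreconnected_univ.subset_of_closure_inter_subset hopen
      ⟨0, mem_univ _, by simpa using haff0⟩ ?_
    rintro t₀ ⟨ht₀, -⟩
    rcases eq_or_ne t₀ 0 with rfl | hne
    · simpa using haff0
    obtain ⟨κ, x, v, hκ, hx, hgeo⟩ := hγ u t₀
    obtain ⟨r, hr, hball⟩ := Metric.isOpen_iff.1 κ.open_target x hx
    have hin : ∀ᶠ t in 𝓝 t₀, x + (t - t₀) • v ∈ Metric.ball x r :=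
      (AffineAtlas.tendsto_line x v t₀).eventually_mem (Metric.ball_mem_nhds x hr)
    obtain ⟨t₁, ht₁, hev⟩ := ((mem_closure_iff_frequently.1 ht₀).and_eventually
      (hgeo.and hin).eventually_nhds).exists
    obtain ⟨hgeo₁, hin₁⟩ := hev.self_of_nhds
    -- the local affine form at `t₁ u`, in the chart `κ`
    obtain ⟨L, hL⟩ := IsAffineAt.exists_eventually_eq ht₁ hκ (hball hin₁)
      (by rw [← hgeo₁, hscale u t₁])
    have hLu : L u = v := by
      have hc : Tendsto (fun t : ℝ => t • u) (𝓝 t₁) (𝓝 (t₁ • u)) := tendsto_id.smul_const u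
      have hin₂ : ∀ᶠ t in 𝓝 t₁, x + (t₁ - t₀) • v + (t - t₁) • L u ∈ κ.target :=
        (AffineAtlas.tendsto_line _ (L u) t₁).eventually_mem (κ.open_target.mem_nhds (hball hin₁))
      have h1 : ∀ᶠ t in 𝓝[≠] t₁, (t - t₁) • L u = (t - t₁) • v ∧ t ≠ t₁ := by
        refine (((hc.eventually hL).and (hin₂.and hev)).filter_mono nhdsWithin_le_nhds).and
          self_mem_nhdsWithin |>.mono ?_
        rintro t ⟨⟨h1, h2, h3, h4⟩, h5⟩
        refine ⟨?_, h5⟩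
        rw [← hscale, h3, ← sub_smul, map_smul] at h1
        have h6 := κ.symm.injOn (hball h4) h2 h1
        rw [add_assoc] at h6
        rw [eq_sub_iff_add_eq'.2 (add_left_cancel h6).symm, ← sub_smul]
        congr 1
        ring
      obtain ⟨t, h2, h3⟩ := h1.exists
      exact smul_right_injective _ (sub_ne_zero.2 h3) h2
    -- the geodesics close to the ray are straight lines in `κ` from time `t₁ / t₀` to time `1`
    have hform : ∀ w : Euc n, x + (t₁ - t₀) • v + L (w - t₁ • u) = x - t₀ • v + L w := by
      intro w
      rw [map_sub, map_smul, hLu, sub_smul]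
      abel
    refine ⟨κ, x, L, hκ, hx, ?_⟩
    have hc : Tendsto (fun w : Euc n => (t₁ / t₀) • w) (𝓝 (t₀ • u)) (𝓝 (t₁ • u)) := by
      have : Continuous (fun w : Euc n => (t₁ / t₀) • w) := by fun_prop
      simpa [smul_smul, div_mul_cancel₀ _ hne] using this.tendsto (t₀ • u)
    have hc₁ : ∀ᶠ w in 𝓝 (t₀ • u), x - t₀ • v + (t₁ / t₀) • L w ∈ Metric.ball x r := by
      have : Continuous (fun w : Euc n => x - t₀ • v + (t₁ / t₀) • L w) := by fun_prop
      refine (this.tendsto (t₀ • u)).eventually_mem (Metric.isOpen_ball.mem_nhds ?_)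
      rwa [map_smul, hLu, smul_smul, div_mul_cancel₀ _ hne, sub_add, ← sub_smul, ← neg_sub t₁ t₀,
        neg_smul, sub_neg_eq_add]
    have hc₂ : ∀ᶠ w in 𝓝 (t₀ • u), x - t₀ • v + (1 : ℝ) • L w ∈ Metric.ball x r := by
      have : Continuous (fun w : Euc n => x - t₀ • v + (1 : ℝ) • L w) := by fun_prop
      refine (this.tendsto (t₀ • u)).eventually_mem (Metric.isOpen_ball.mem_nhds ?_)
      simpa [hLu] using hr
    filter_upwards [hc.eventually hL.eventually_nhds, hc₁, hc₂] with w h1 h2 h3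
    have hs : ∀ s ∈ uIcc (t₁ / t₀) 1,
        (baseAtlas n Q).IsStraightAt (fun t => κ.symm (x - t₀ • v + t • L w)) s := by
      intro s hs
      refine hline hκ (hball ?_)
      have hconv : Convex ℝ {s : ℝ | x - t₀ • v + s • L w ∈ Metric.ball x r} := by
        intro s hs t ht a b ha hb hab
        have := convex_ball x r hs ht ha hb hab
        rw [mem_ofPred_eq]
        convert this using 1
        obtain rfl : b = 1 - a := by linarith
        module
      rw [← segment_eq_uIcc] at hs
      exact hconv.segment_subset h2 h3 hs
    have h0 : γ w =ᶠ[𝓝 (t₁ / t₀)] fun t => κ.symm (x - t₀ • v + t • L w) := by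
      have hc' : Tendsto (fun s : ℝ => s • w) (𝓝 (t₁ / t₀)) (𝓝 ((t₁ / t₀) • w)) :=
        tendsto_id.smul_const w
      filter_upwards [hc'.eventually h1] with s h4
      rw [hscale, h4, hform, map_smul]
    have := ((baseAtlas n Q).eventuallyEq_of_isStraightAt isPreconnected_uIcc
      (fun s _ => hstr w s) hs left_mem_uIcc h0 1 right_mem_uIcc).self_of_nhds
    rw [this, map_sub, map_smul, hLu]
    dsimp only
    rw [one_smul]
    congr 1
    abel
  simpa using hall (mem_univ (1 : ℝ))

end Base

/-! ### The exponential map of the phase space -/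

section PhaseExp

variable {n : ℕ} {Q : Type*} [TopologicalSpace Q] [ChartedSpace (Euc n) Q]
  [RiemannianBundle (fun q : Q => TQ (n := n) q)]

/-- The transition maps of the cotangent charts are locally affine over `ℂ`. -/
theorem IsFlatChart.exists_phase_transition {κ κ' : OpenPartialHomeomorph Q (Euc n)}
    (hκ : IsFlatChart κ) (hκ' : IsFlatChart κ') {z w : Fin n → ℂ} (hz : z ∈ cotangentDomain κ)
    (hw : w ∈ cotangentDomain κ') (h : cotangentParam κ z = cotangentParam κ' w) :
    ∃ L : Euc n ≃ₗᵢ[ℝ] Euc n,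
      (∀ᶠ z' in 𝓝 z, cotangentParam κ z' =
        cotangentParam κ' (w + complexify L.toLinearEquiv (z' - z))) ∧
      ∀ v, chartDeriv κ' (κ.symm (rePart z)) v = L (chartDeriv κ (κ.symm (rePart z)) v) := by
  have hq : κ.symm (rePart z) = κ'.symm (rePart w) := congrArg TotalSpace.proj h
  obtain ⟨L, hL⟩ := hκ.exists_symm_transition hκ' hz hw hq
  refine ⟨L, ?_, hL.self_of_nhds.2⟩
  have him : imPart w = L (imPart z) := by
    have h1 := cotangentParam_eq_of_transition hq hL.self_of_nhds.2 (imPart z)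
    rw [toComplex_rePart_imPart, h] at h1
    have h2 := cotangentParam_injOn hκ' hw
      (show toComplex (rePart w) (L (imPart z)) ∈ cotangentDomain κ' from hw) h1
    rw [h2, imPart_toComplex]
  have hc : Tendsto (rePart (n := n)) (𝓝 z) (𝓝 (rePart z)) := continuous_rePart.tendsto z
  filter_upwards [hc.eventually hL] with z' hz'
  have h1 := cotangentParam_eq_of_transition hz'.1 hz'.2 (imPart z')
  rw [toComplex_rePart_imPart] at h1
  rw [h1, complexify_apply, ← toComplex_rePart_imPart w, toComplex_add, him]
  simp

variable (n Q) in
/-- The affine structure of the phase space. -/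
noncomputable def phaseAtlas [T2Space Q] :
    AffineAtlas {κ : OpenPartialHomeomorph Q (Euc n) // IsFlatChart κ} (Fin n → ℂ) (Phase n Q) where
  dom κ := cotangentDomain κ.1
  param κ := cotangentParam κ.1
  isOpen_dom κ := isOpen_cotangentDomain κ.1
  injOn κ := cotangentParam_injOn κ.2
  transition κ κ' z w hz hw h := by
    obtain ⟨L, hL, -⟩ := κ.2.exists_phase_transition κ'.2 hz hw h
    exact ⟨((complexify L.toLinearEquiv : (Fin n → ℂ) →L[ℂ] (Fin n → ℂ))).restrictScalars ℝ, hL⟩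
  separated κ κ' z w hz hw h := by
    by_cases hq : κ.1.symm (rePart z) = κ'.1.symm (rePart w)
    · obtain ⟨L, hL⟩ := κ.2.exists_symm_transition κ'.2 hz hw hq
      -- over the same point of `Q` the two momenta differ
      have h1 := cotangentParam_eq_of_transition hq hL.self_of_nhds.2 (imPart z)
      rw [toComplex_rePart_imPart] at h1
      have hne : toComplex (rePart w) (L (imPart z)) ≠ w := fun h2 => h (by rw [h1, h2])
      have hcont : Continuous fun p : (Fin n → ℂ) × (Fin n → ℂ) =>
          (toComplex (rePart w + L (rePart p.1 - rePart z)) (L (imPart p.1)), p.2) := by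
        have him : Continuous (imPart (n := n)) := by unfold imPart; fun_prop
        have hre := continuous_rePart (n := n)
        have htc : Continuous fun p : Euc n × Euc n => toComplex p.1 p.2 := by
          have : (fun p : Euc n × Euc n => toComplex p.1 p.2) =
              fun p k => ((p.1 k : ℝ) : ℂ) + ((p.2 k : ℝ) : ℂ) * Complex.I := by
            ext p k
            simp [toComplex, Complex.ext_iff]
          rw [this]
          fun_prop
        refine Continuous.prodMk (htc.comp (Continuous.prodMk ?_ ?_)) continuous_snd
        · fun_prop
        · fun_prop
      have hev : ∀ᶠ p in 𝓝 (z, w),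
          (toComplex (rePart w + L (rePart p.1 - rePart z)) (L (imPart p.1)), p.2).1 ≠ p.2 ∧
          toComplex (rePart w + L (rePart p.1 - rePart z)) (L (imPart p.1)) ∈ cotangentDomain κ'.1 ∧
          p.2 ∈ cotangentDomain κ'.1 := by
        refine (hcont.continuousAt.eventually_mem
          ((isClosed_diagonal (X := Fin n → ℂ)).isOpen_compl.mem_nhds ?_)).and
          ((hcont.fst.continuousAt.eventually_mem
            ((isOpen_cotangentDomain κ'.1).mem_nhds ?_)).and
          (continuous_snd.continuousAt.eventually_mem ((isOpen_cotangentDomain κ'.1).mem_nhds hw)))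
        · intro h2
          refine hne ?_
          have h3 : toComplex (rePart w + L (rePart z - rePart z)) (L (imPart z)) = w := h2
          simpa using h3
        · change rePart (toComplex (rePart w + L (rePart z - rePart z)) _) ∈ κ'.1.target
          rw [sub_self, map_zero, add_zero, rePart_toComplex]
          exact hw
      have hc : Tendsto (fun p : (Fin n → ℂ) × (Fin n → ℂ) => rePart p.1) (𝓝 (z, w))
          (𝓝 (rePart z)) := (continuous_rePart.comp continuous_fst).tendsto (z, w)
      rw [← nhds_prod_eq]
      filter_upwards [hev, hc.eventually hL] with p hp hpL heq
      have h4 := cotangentParam_eq_of_transition hpL.1 hpL.2 (imPart p.1)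
      rw [toComplex_rePart_imPart, heq] at h4
      exact hp.1 (cotangentParam_injOn κ'.2 hp.2.2 hp.2.1 h4).symm
    · have h1 := (baseAtlas n Q).separated κ κ' (rePart z) (rePart w) hz hw hq
      have h2 : Tendsto (fun p : (Fin n → ℂ) × (Fin n → ℂ) => (rePart p.1, rePart p.2))
          (𝓝 z ×ˢ 𝓝 w) (𝓝 (rePart z) ×ˢ 𝓝 (rePart w)) :=
        (continuous_rePart.tendsto z).prodMap (continuous_rePart.tendsto w)
      filter_upwards [h2.eventually h1] with p hp heq
      exact hp (congrArg TotalSpace.proj heq)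

theorem linearIsometryEquiv_eq_of_eventually {L R : Euc n ≃ₗᵢ[ℝ] Euc n} {u : Euc n}
    (h : ∀ᶠ u' in 𝓝 u, L (u' - u) = R (u' - u)) (v : Euc n) : L v = R v := by
  have hc : Tendsto (fun t : ℝ => u + t • v) (𝓝[≠] 0) (𝓝 u) := by
    have : Continuous fun t : ℝ => u + t • v := by fun_prop
    simpa using (this.tendsto 0).mono_left nhdsWithin_le_nhds
  obtain ⟨t, ht, hne⟩ := ((hc.eventually h).and self_mem_nhdsWithin).exists
  simp only [add_sub_cancel_left, map_smul] at ht
  exact smul_right_injective _ hne ht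

/-- The lift to the phase space of a local isometry `F : ℝⁿ → Q`: the vector `u + i v` is sent to
the covector `⟨c + v, (dF_u)⁻¹ ·⟩` at `F u`. -/
theorem exists_phaseLift {F : Euc n → Q} (hF : ∀ u, IsAffineAt F u) (c : Euc n) :
    ∃ E : (Fin n → ℂ) → Phase n Q, ∀ (κ : OpenPartialHomeomorph Q (Euc n)) (z : Fin n → ℂ)
      (x : Euc n) (L : Euc n ≃ₗᵢ[ℝ] Euc n), IsFlatChart κ → x ∈ κ.target →
      (∀ᶠ u' in 𝓝 (rePart z), F u' = κ.symm (x + L (u' - rePart z))) →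
      E z = cotangentParam κ (toComplex x (L (c + imPart z))) := by
  choose κ₁ x₁ L₁ hκ₁ hx₁ h₁ using hF
  refine ⟨fun z => cotangentParam (κ₁ (rePart z))
    (toComplex (x₁ (rePart z)) (L₁ (rePart z) (c + imPart z))), ?_⟩
  intro κ z x L hκ hx hF
  dsimp only
  generalize hu : rePart z = u at *
  have hq : (κ₁ u).symm (x₁ u) = κ.symm x := by
    have h1 := (h₁ u).self_of_nhds
    have h2 := hF.self_of_nhds
    rw [h1] at h2
    simpa using h2
  obtain ⟨R, hR⟩ := (hκ₁ u).exists_symm_transition hκ (hx₁ u) hx hq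
  have hLR : ∀ v, (L₁ u).trans R v = L v := by
    refine linearIsometryEquiv_eq_of_eventually (u := u) ?_
    filter_upwards [h₁ u, hF, (tendsto_affine (x₁ u) u (L₁ u) (L₁ u).continuous
      (map_zero _)).eventually hR, (tendsto_affine x u L L.continuous
      (map_zero _)).eventually_mem (κ.open_target.mem_nhds hx),
      (tendsto_affine x u ((L₁ u).trans R) ((L₁ u).trans R).continuous
      (map_zero _)).eventually_mem (κ.open_target.mem_nhds hx)] with u' h1 h2 h3 h4 h5
    have h6 := h3.1
    rw [← h1, h2, add_sub_cancel_left] at h6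
    exact (add_left_cancel (κ.symm.injOn h4 h5 h6)).symm
  rw [cotangentParam_eq_of_transition hq hR.self_of_nhds.2, ← hLR]
  rfl

/-- The lift of a local isometry is locally affine over `ℂ`. -/
theorem exists_phaseLift_affine {F : Euc n → Q} (hF : ∀ u, IsAffineAt F u) (c : Euc n) :
    ∃ E : (Fin n → ℂ) → Phase n Q, ∀ (κ : OpenPartialHomeomorph Q (Euc n)) (z : Fin n → ℂ)
      (x : Euc n) (L : Euc n ≃ₗᵢ[ℝ] Euc n), IsFlatChart κ → x ∈ κ.target →
      (∀ᶠ u' in 𝓝 (rePart z), F u' = κ.symm (x + L (u' - rePart z))) →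
      ∀ᶠ z' in 𝓝 z, E z' = cotangentParam κ
        (toComplex x (L (c + imPart z)) + complexify L.toLinearEquiv (z' - z)) := by
  obtain ⟨E, hE⟩ := exists_phaseLift hF c
  refine ⟨E, fun κ z x L hκ hx h => ?_⟩
  have hc : Tendsto (rePart (n := n)) (𝓝 z) (𝓝 (rePart z)) := continuous_rePart.tendsto z
  filter_upwards [hc.eventually h.eventually_nhds,
    hc.eventually ((tendsto_affine x (rePart z) L L.continuous (map_zero _)).eventually_mem
      (κ.open_target.mem_nhds hx))] with z' h1 h2
  rw [hE κ z' (x + L (rePart z' - rePart z)) L hκ h2 (h1.mono fun u' h3 => by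
    rw [h3, add_assoc, ← map_add]
    congr 3
    abel), complexify_apply, toComplex_add]
  congr 2
  change L (c + imPart z') = L (c + imPart z) + L (imPart z' - imPart z)
  rw [← map_add]
  congr 1
  abel

/-- The linear coordinates on the tangent space at a point of `P` given by a flat chart, in terms of
those given by a basis. -/
noncomputable def velocityEquiv {κ : OpenPartialHomeomorph Q (Euc n)} (hκ : IsFlatChart κ) {q : Q}
    (hq : q ∈ κ.source) (b : Module.Basis (Fin n) ℝ (TQ (n := n) q)) :
    (Fin n → ℂ) ≃L[ℂ] (Fin n → ℂ) :=
  (LinearEquiv.ofInjectiveEndo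
    { toFun := velocity κ b
      map_add' := fun z w => by ext k; simp [velocity, add_mul, Finset.sum_add_distrib]
      map_smul' := fun c z => by ext k; simp [velocity, Finset.mul_sum, mul_assoc] }
    (by
      refine (injective_iff_map_eq_zero _).2 fun z hz => ?_
      change velocity κ b z = 0 at hz
      rw [velocity_eq] at hz
      have hre : chartDeriv κ q (∑ i, (z i).re • b i) = 0 := congrArg rePart hz
      have him : chartDeriv κ q (∑ i, (z i).im • b i) = 0 := congrArg imPart hz
      have hre' := (hκ.chartDeriv_injective hq) (hre.trans (map_zero _).symm)
      have him' := (hκ.chartDeriv_injective hq) (him.trans (map_zero _).symm)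
      ext i
      exact Complex.ext (Fintype.linearIndependent_iff.1 b.linearIndependent _ hre' i)
        (Fintype.linearIndependent_iff.1 b.linearIndependent _ him' i))).toContinuousLinearEquiv

/-- Every covector over the domain of a flat chart lies in the range of the cotangent chart. -/
theorem exists_cotangentParam_eq {κ : OpenPartialHomeomorph Q (Euc n)} (hκ : IsFlatChart κ)
    (o : Phase n Q) (ho : o.proj ∈ κ.source) :
    ∃ c : Euc n, cotangentParam κ (toComplex (κ o.proj) c) = o := by
  obtain ⟨q, p⟩ := o
  -- the tangent space at `q` is `ℝⁿ` by definition, with a different norm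
  let D : Euc n →L[ℝ] Euc n := chartDeriv κ q
  let D' : Euc n ≃ₗ[ℝ] Euc n := LinearEquiv.ofBijective D.toLinearMap (hκ.chartDeriv_bijective ho)
  let p' : Euc n →L[ℝ] ℝ := p
  let ℓ : Euc n →L[ℝ] ℝ := p'.comp (LinearMap.toContinuousLinearMap D'.symm.toLinearMap)
  refine ⟨(InnerProductSpace.toDual ℝ (Euc n)).symm ℓ, ?_⟩
  rw [cotangentParam_toComplex]
  refine phase_ext (κ.left_inv ho) fun v => ?_
  rw [κ.left_inv ho]
  change inner ℝ ((InnerProductSpace.toDual ℝ (Euc n)).symm ℓ) (D v) = p v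
  rw [InnerProductSpace.toDual_symm_apply]
  change p' (D'.symm (D' v)) = p' v
  rw [D'.symm_apply_apply]

variable [T2Space Q]

/-- A geodesic of the phase space is determined by its initial point and velocity. -/
theorem IsGeodesic.eq_of_startsWith {o : Phase n Q}
    {b : Module.Basis (Fin n) ℝ (TQ (n := n) o.proj)} {z : Fin n → ℂ} {γ₁ γ₂ : ℝ → Phase n Q}
    (h₁ : IsGeodesic γ₁) (h₂ : IsGeodesic γ₂) (hs₁ : StartsWith o b z γ₁)
    (hs₂ : StartsWith o b z γ₂) : γ₁ = γ₂ := by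
  have hstr : ∀ γ : ℝ → Phase n Q, IsGeodesic γ → ∀ t, (phaseAtlas n Q).IsStraightAt γ t := by
    intro γ hγ t
    obtain ⟨κ, w, V, hκ, hw, h⟩ := hγ t
    exact ⟨⟨κ, hκ⟩, w, V, hw, h⟩
  have h0 : γ₁ =ᶠ[𝓝 0] γ₂ := by
    obtain ⟨κ, w, hκ, hw, hwo, h⟩ := hs₁
    obtain ⟨κ', w', hκ', hw', hwo', h'⟩ := hs₂
    obtain ⟨L, hL, hd⟩ := hκ.exists_phase_transition hκ' hw hw' (hwo.trans hwo'.symm)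
    have hproj : κ.symm (rePart w) = o.proj := congrArg TotalSpace.proj hwo
    rw [hproj] at hd
    have hV : complexify L.toLinearEquiv (velocity κ b z) = velocity κ' b z := by
      rw [velocity_eq, velocity_eq, complexify_apply, hd, hd]
      rfl
    have ht : Tendsto (fun t : ℝ => w + (t : ℂ) • velocity κ b z) (𝓝 0) (𝓝 w) := by
      have : Continuous fun t : ℝ => w + (t : ℂ) • velocity κ b z := by fun_prop
      simpa using this.tendsto 0
    filter_upwards [h, h', ht.eventually hL] with t h1 h2 h3
    rw [h1, h2, h3, add_sub_cancel_left, map_smul, hV]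
  funext t
  exact ((phaseAtlas n Q).eventuallyEq_of_isStraightAt isPreconnected_univ
    (fun t _ => hstr γ₁ h₁ t) (fun t _ => hstr γ₂ h₂ t) (mem_univ 0) h0 t (mem_univ t)).self_of_nhds

theorem expMap_eq {o : Phase n Q} {b : Module.Basis (Fin n) ℝ (TQ (n := n) o.proj)}
    {z : Fin n → ℂ} {γ : ℝ → Phase n Q} (h : IsGeodesic γ) (hs : StartsWith o b z γ) :
    expMap o b z = γ 1 := by
  have hex : ∃ γ : ℝ → Phase n Q, IsGeodesic γ ∧ StartsWith o b z γ := ⟨γ, h, hs⟩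
  rw [expMap, dif_pos hex, hex.choose_spec.1.eq_of_startsWith h hex.choose_spec.2 hs]

/-- The exponential map of the phase space is locally affine and invertible over `ℂ` in the complex
coordinates of some flat chart. -/
theorem exists_expMap_eventually_eq (hflat : IsFlat n Q) (hcomplete : GeodesicallyComplete n Q)
    (o : Phase n Q) (b : Module.Basis (Fin n) ℝ (TQ (n := n) o.proj)) (z : Fin n → ℂ) :
    ∃ (κ : OpenPartialHomeomorph Q (Euc n)) (w : Fin n → ℂ) (A : (Fin n → ℂ) ≃L[ℂ] (Fin n → ℂ)),
      IsFlatChart κ ∧ w ∈ cotangentDomain κ ∧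
        ∀ᶠ z' in 𝓝 z, expMap o b z' = cotangentParam κ (w + A (z' - z)) := by
  obtain ⟨κ₀, hκ₀, hq₀⟩ := hflat o.proj
  obtain ⟨c, hc⟩ := exists_cotangentParam_eq hκ₀ o hq₀
  obtain ⟨F, hF0, hF⟩ := exists_baseExp hcomplete hκ₀ (κ₀.map_source hq₀)
  obtain ⟨E, hE⟩ := exists_phaseLift_affine hF c
  have hlocal : ∀ Z : Fin n → ℂ, ∃ (κ : OpenPartialHomeomorph Q (Euc n)) (w : Fin n → ℂ)
      (A : (Fin n → ℂ) ≃L[ℂ] (Fin n → ℂ)), IsFlatChart κ ∧ w ∈ cotangentDomain κ ∧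
        ∀ᶠ Z' in 𝓝 Z, E Z' = cotangentParam κ (w + A (Z' - Z)) := by
    intro Z
    obtain ⟨κ, x, L, hκ, hx, h⟩ := hF (rePart Z)
    exact ⟨κ, _, _, hκ, hx, hE κ Z x L hκ hx h⟩
  have hexp : ∀ z, expMap o b z = E (velocityEquiv hκ₀ hq₀ b z) := by
    intro z
    have hgeo : IsGeodesic fun t : ℝ => E ((t : ℂ) • velocityEquiv hκ₀ hq₀ b z) := by
      intro t₀
      obtain ⟨κ, w, A, hκ, hw, h⟩ := hlocal ((t₀ : ℂ) • velocityEquiv hκ₀ hq₀ b z)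
      refine ⟨κ, w, A (velocityEquiv hκ₀ hq₀ b z), hκ, hw, ?_⟩
      have ht : Continuous fun t : ℝ => (t : ℂ) • velocityEquiv hκ₀ hq₀ b z := by fun_prop
      filter_upwards [(ht.tendsto t₀).eventually h] with t h1
      rw [h1, ← sub_smul, map_smul, Complex.ofReal_sub]
    have hstart : StartsWith o b z fun t : ℝ => E ((t : ℂ) • velocityEquiv hκ₀ hq₀ b z) := by
      have h0 := hE κ₀ 0 (κ₀ o.proj) (LinearIsometryEquiv.refl ℝ _) hκ₀ (κ₀.map_source hq₀) (by
        have : rePart (0 : Fin n → ℂ) = 0 := rfl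
        rw [this]
        simpa using hF0)
      have him : imPart (0 : Fin n → ℂ) = 0 := rfl
      refine ⟨κ₀, toComplex (κ₀ o.proj) c, hκ₀, κ₀.map_source hq₀, hc, ?_⟩
      have ht : Tendsto (fun t : ℝ => (t : ℂ) • velocityEquiv hκ₀ hq₀ b z) (𝓝 0) (𝓝 0) := by
        have : Continuous fun t : ℝ => (t : ℂ) • velocityEquiv hκ₀ hq₀ b z := by fun_prop
        simpa using this.tendsto 0
      filter_upwards [ht.eventually h0] with t h1
      rw [h1, him, sub_zero, complexify_apply, add_zero]
      rfl
    rw [expMap_eq hgeo hstart]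
    simp
  obtain ⟨κ, w, A, hκ, hw, h⟩ := hlocal (velocityEquiv hκ₀ hq₀ b z)
  refine ⟨κ, w, (velocityEquiv hκ₀ hq₀ b).trans A, hκ, hw, ?_⟩
  have ht := (velocityEquiv hκ₀ hq₀ b).continuous.tendsto z
  filter_upwards [ht.eventually h] with z' h1
  rw [hexp, h1, ← map_sub]
  rfl

/-- The exponential map is locally affine in every flat chart. -/
theorem expMap_eventually_eq (hflat : IsFlat n Q) (hcomplete : GeodesicallyComplete n Q)
    (o : Phase n Q) (b : Module.Basis (Fin n) ℝ (TQ (n := n) o.proj)) {z w : Fin n → ℂ}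
    {κ : OpenPartialHomeomorph Q (Euc n)} (hκ : IsFlatChart κ) (hw : w ∈ cotangentDomain κ)
    (h : expMap o b z = cotangentParam κ w) :
    ∃ A : (Fin n → ℂ) ≃L[ℂ] (Fin n → ℂ),
      ∀ᶠ z' in 𝓝 z, expMap o b z' = cotangentParam κ (w + A (z' - z)) := by
  obtain ⟨κ₁, w₁, A, hκ₁, hw₁, h₁⟩ := exists_expMap_eventually_eq hflat hcomplete o b z
  have heq : cotangentParam κ₁ w₁ = cotangentParam κ w := by
    rw [← h, h₁.self_of_nhds]; simp
  obtain ⟨L, hL, -⟩ := hκ₁.exists_phase_transition hκ hw₁ hw heq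
  refine ⟨A.trans (complexify L.toLinearEquiv), ?_⟩
  filter_upwards [h₁, (tendsto_affine w₁ z A A.continuous (map_zero A)).eventually hL]
    with z' h1 h2
  rw [h1, h2, add_sub_cancel_left]
  rfl

/-- As the exponential map is a surjective local biholomorphism, a function on the phase space is
holomorphic if and only if its pull-back to the tangent space is entire. -/
theorem holomorphic_iff (hflat : IsFlat n Q) (hcomplete : GeodesicallyComplete n Q)
    (o : Phase n Q) (b : Module.Basis (Fin n) ℝ (TQ (n := n) o.proj))
    (hsurj : Function.Surjective (expMap o b)) (φ : Phase n Q → ℂ) :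
    Holomorphic φ ↔ Differentiable ℂ (fun z => φ (expMap o b z)) := by
  constructor
  · intro hφ z
    obtain ⟨κ, w, A, hκ, hw, h⟩ := exists_expMap_eventually_eq hflat hcomplete o b z
    have h1 : DifferentiableAt ℂ (fun z => φ (cotangentParam κ z)) (w + A (z - z)) := by
      rw [sub_self, map_zero, add_zero]
      exact (hφ κ hκ).differentiableAt ((isOpen_cotangentDomain κ).mem_nhds hw)
    have h2 : DifferentiableAt ℂ (fun z' => w + A (z' - z)) z := by fun_prop
    refine (h1.comp z h2).congr_of_eventuallyEq ?_
    filter_upwards [h] with z' h3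
    rw [h3]
    rfl
  · intro hφ κ hκ w hw
    obtain ⟨z, hz⟩ := hsurj (cotangentParam κ w)
    obtain ⟨A, hA⟩ := expMap_eventually_eq hflat hcomplete o b hκ hw hz
    refine DifferentiableAt.differentiableWithinAt ?_
    have h1 : DifferentiableAt ℂ (fun w' => φ (expMap o b (z + A.symm (w' - w)))) w :=
      (hφ _).comp w (by fun_prop)
    refine h1.congr_of_eventuallyEq ?_
    filter_upwards [(tendsto_affine z w A.symm A.symm.continuous (map_zero _)).eventually hA]
      with w' h3
    rw [h3]
    simp

end PhaseExp

/-! ### Mean value inequality and Gaussian bounds for entire functions -/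

section MeanValue

variable {n : ℕ}

theorem measurePreserving_smul_of_norm_eq_one {c : ℂ} (hc : ‖c‖ = 1) :
    MeasurePreserving (fun z : Fin n → ℂ => c • z) := by
  have h1 : MeasurePreserving (fun x : ℂ => c * x) := by
    have := (rotation (⟨c, by simp [Submonoid.unitSphere, hc]⟩ : Circle)).measurePreserving
    exact this
  exact volume_preserving_pi (fun _ : Fin n => h1)

/-- Mean value inequality over a polydisc: the mean value property on the circles `θ ↦ e^{iθ} ζ` is
integrated over `ζ`, using that rotations preserve the polydisc and the Lebesgue measure. -/
theorem enorm_mul_volume_le_lintegral {g : (Fin n → ℂ) → ℂ} (hg : Differentiable ℂ g) (r : ℝ) :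
    ‖g 0‖ₑ * volume (Metric.ball (0 : Fin n → ℂ) r) ≤ ∫⁻ z in Metric.ball 0 r, ‖g z‖ₑ := by
  have hpi : (0 : ℝ) < 2 * Real.pi := Real.two_pi_pos
  have hcirc : ∀ ζ : Fin n → ℂ, ENNReal.ofReal (2 * Real.pi) * ‖g 0‖ₑ ≤
      ∫⁻ θ in Ioc 0 (2 * Real.pi), ‖g (circleMap 0 1 θ • ζ)‖ₑ := by
    intro ζ
    have hd : Differentiable ℂ fun c : ℂ => g (c • ζ) := hg.comp (by fun_prop)
    have h1 := (hd.diffContOnCl (s := Metric.ball 0 |1|)).circleAverage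
    rw [zero_smul, Real.circleAverage, intervalIntegral.integral_of_le hpi.le] at h1
    have h2 : (2 * Real.pi) • g 0 =
        ∫ θ in Ioc 0 (2 * Real.pi), g (circleMap 0 1 θ • ζ) := by
      rw [← h1, smul_smul, mul_inv_cancel₀ hpi.ne', one_smul]
    have h3 := enorm_integral_le_lintegral_enorm (μ := volume.restrict (Ioc 0 (2 * Real.pi)))
      fun θ => g (circleMap 0 1 θ • ζ)
    rwa [← h2, enorm_smul, Real.enorm_of_nonneg hpi.le] at h3
  have hcont : Continuous fun p : (Fin n → ℂ) × ℝ => ‖g (circleMap 0 1 p.2 • p.1)‖ₑ :=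
    (hg.continuous.comp (((continuous_circleMap 0 1).comp continuous_snd).smul
      continuous_fst)).enorm
  have hrot : ∀ θ : ℝ, ∫⁻ ζ in Metric.ball 0 r, ‖g (circleMap 0 1 θ • ζ)‖ₑ =
      ∫⁻ ζ in Metric.ball (0 : Fin n → ℂ) r, ‖g ζ‖ₑ := by
    intro θ
    have hc : ‖circleMap 0 1 θ‖ = 1 := by simp
    have h1 := (measurePreserving_smul_of_norm_eq_one (n := n) hc).restrict_preimage
      (s := Metric.ball 0 r) Metric.isOpen_ball.measurableSet
    have h2 : (fun z : Fin n → ℂ => circleMap 0 1 θ • z) ⁻¹' Metric.ball 0 r = Metric.ball 0 r := by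
      ext z
      simp [norm_smul]
    rw [h2] at h1
    exact h1.lintegral_comp hg.continuous.enorm.measurable
  have hfin : ENNReal.ofReal (2 * Real.pi) ≠ 0 := by simpa using Real.pi_pos
  refine (ENNReal.mul_le_mul_iff_right hfin ENNReal.ofReal_ne_top).1 ?_
  calc ENNReal.ofReal (2 * Real.pi) * (‖g 0‖ₑ * volume (Metric.ball (0 : Fin n → ℂ) r))
      = ∫⁻ _ in Metric.ball (0 : Fin n → ℂ) r, ENNReal.ofReal (2 * Real.pi) * ‖g 0‖ₑ := by
        rw [setLIntegral_const, mul_assoc]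
    _ ≤ ∫⁻ ζ in Metric.ball (0 : Fin n → ℂ) r,
          ∫⁻ θ in Ioc 0 (2 * Real.pi), ‖g (circleMap 0 1 θ • ζ)‖ₑ :=
        lintegral_mono fun ζ => hcirc ζ
    _ = ∫⁻ θ in Ioc 0 (2 * Real.pi),
          ∫⁻ ζ in Metric.ball (0 : Fin n → ℂ) r, ‖g (circleMap 0 1 θ • ζ)‖ₑ :=
        lintegral_lintegral_swap hcont.measurable.aemeasurable
    _ = ENNReal.ofReal (2 * Real.pi) * ∫⁻ ζ in Metric.ball (0 : Fin n → ℂ) r, ‖g ζ‖ₑ := by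
        simp_rw [hrot]
        rw [setLIntegral_const, Real.volume_Ioc, sub_zero, mul_comm]

theorem sq_enorm_mul_volume_le_lintegral {f : (Fin n → ℂ) → ℂ} (hf : Differentiable ℂ f)
    (z : Fin n → ℂ) (r : ℝ) :
    ‖f z‖ₑ ^ 2 * volume (Metric.ball (0 : Fin n → ℂ) r) ≤
      ∫⁻ w in Metric.ball z r, ‖f w‖ₑ ^ 2 := by
  have hg : Differentiable ℂ fun ζ => f (z + ζ) ^ 2 := (hf.comp (by fun_prop)).pow 2
  have h1 := enorm_mul_volume_le_lintegral hg r
  simp only [add_zero, enorm_pow] at h1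
  refine h1.trans_eq ?_
  have h2 := (measurePreserving_add_left (volume : Measure (Fin n → ℂ)) z).restrict_preimage
    (s := Metric.ball z r) Metric.isOpen_ball.measurableSet
  have h3 : (fun ζ : Fin n → ℂ => z + ζ) ⁻¹' Metric.ball z r = Metric.ball 0 r := by
    ext ζ
    simp
  rw [h3] at h2
  exact h2.lintegral_comp (f := fun w => ‖f w‖ₑ ^ 2)
    (hf.continuous.enorm.measurable.pow_const 2)

end MeanValue

section Gaussian

variable {n : ℕ} {Q : Type*} [TopologicalSpace Q] [ChartedSpace (Euc n) Q]
  [RiemannianBundle (fun q : Q => TQ (n := n) q)] {q : Q}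
  (b : Module.Basis (Fin n) ℝ (TQ (n := n) q))

theorem continuous_modSq : Continuous (modSq b) := by
  unfold modSq
  fun_prop

theorem measurable_gaussian_density :
    Measurable fun z => ENNReal.ofReal (Real.exp (-modSq b z)) := by
  have := continuous_modSq b
  fun_prop

theorem volume_absolutelyContinuous_gaussian : volume ≪ gaussian b :=
  withDensity_absolutelyContinuous' (measurable_gaussian_density b).aemeasurable
    (Eventually.of_forall fun z => by simpa using Real.exp_pos _)

theorem eq_of_ae_eq_gaussian {f g : (Fin n → ℂ) → ℂ} (hf : Continuous f) (hg : Continuous g)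
    (h : f =ᵐ[gaussian b] g) : f = g :=
  Measure.eq_of_ae_eq ((volume_absolutelyContinuous_gaussian b).ae_le h) hf hg

/-- Locally uniform bound of an entire function by its Gaussian `L²` norm. -/
theorem exists_enorm_le_eLpNorm (z₀ : Fin n → ℂ) :
    ∃ D : ENNReal, D ≠ ⊤ ∧ ∀ f : (Fin n → ℂ) → ℂ, Differentiable ℂ f →
      ∀ z ∈ Metric.ball z₀ 2, ‖f z‖ₑ ≤ D * eLpNorm f 2 (gaussian b) := by
  -- a unit ball with centre in `ball z₀ 2` lies in `closedBall z₀ 3`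
  obtain ⟨M, hM⟩ := (isCompact_closedBall z₀ 3).exists_bound_of_continuousOn
    (continuous_modSq b).continuousOn
  set m : ENNReal := ENNReal.ofReal (Real.exp (-M)) with hm
  have hm0 : m ≠ 0 := by simpa [hm] using Real.exp_pos _
  have hmt : m ≠ ⊤ := ENNReal.ofReal_ne_top
  set v : ENNReal := volume (Metric.ball (0 : Fin n → ℂ) 1)
  have hv0 : v ≠ 0 := (Metric.measure_ball_pos volume _ one_pos).ne'
  have hvt : v ≠ ⊤ := measure_ball_lt_top.ne
  have hmv0 : m * v ≠ 0 := mul_ne_zero hm0 hv0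
  have hmvt : m * v ≠ ⊤ := ENNReal.mul_ne_top hmt hvt
  refine ⟨max 1 (m * v)⁻¹, by simp [hmv0], fun f hf z hz => ?_⟩
  have h1 : m * v * ‖f z‖ₑ ^ 2 ≤ eLpNorm f 2 (gaussian b) ^ 2 := by
    have h2 : eLpNorm f 2 (gaussian b) ^ 2 = ∫⁻ w, ‖f w‖ₑ ^ 2 ∂(gaussian b) := by
      have := eLpNorm_nnreal_pow_eq_lintegral (p := 2) (f := f) (μ := gaussian b) two_ne_zero
      simpa using this
    have hmeas : Measurable fun w => ‖f w‖ₑ ^ 2 :=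
      hf.continuous.enorm.measurable.pow_const 2
    rw [h2, gaussian, lintegral_withDensity_eq_lintegral_mul _ (measurable_gaussian_density b) hmeas]
    calc m * v * ‖f z‖ₑ ^ 2 = m * (‖f z‖ₑ ^ 2 * v) := by ring
      _ ≤ m * ∫⁻ w in Metric.ball z 1, ‖f w‖ₑ ^ 2 := by
        gcongr
        exact sq_enorm_mul_volume_le_lintegral hf z 1
      _ = ∫⁻ w in Metric.ball z 1, m * ‖f w‖ₑ ^ 2 := (lintegral_const_mul _ hmeas).symm
      _ ≤ ∫⁻ w in Metric.ball z 1,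
            ((fun z => ENNReal.ofReal (Real.exp (-modSq b z))) * fun w => ‖f w‖ₑ ^ 2) w := by
        refine setLIntegral_mono' Metric.isOpen_ball.measurableSet fun w hw => ?_
        have hw3 : w ∈ Metric.closedBall z₀ 3 := by
          rw [Metric.mem_closedBall]
          rw [Metric.mem_ball] at hw hz
          linarith [dist_triangle w z z₀]
        have := (le_abs_self _).trans (hM w hw3)
        simp only [Pi.mul_apply]
        gcongr
        exact ENNReal.ofReal_le_ofReal (by gcongr)
      _ ≤ _ := setLIntegral_le_lintegral _ _
  have h3 : ‖f z‖ₑ ^ 2 ≤ (max 1 (m * v)⁻¹ * eLpNorm f 2 (gaussian b)) ^ 2 := by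
    calc ‖f z‖ₑ ^ 2 = (m * v)⁻¹ * (m * v * ‖f z‖ₑ ^ 2) := by
          rw [← mul_assoc, ENNReal.inv_mul_cancel hmv0 hmvt, one_mul]
      _ ≤ max 1 (m * v)⁻¹ ^ 2 * eLpNorm f 2 (gaussian b) ^ 2 := by
          gcongr
          calc (m * v)⁻¹ ≤ 1 * max 1 (m * v)⁻¹ := by simp
            _ ≤ max 1 (m * v)⁻¹ ^ 2 := by
              rw [sq]
              gcongr
              exact le_max_left _ _
      _ = _ := by rw [mul_pow]
  exact (ENNReal.pow_le_pow_left_iff two_ne_zero).1 h3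

/-- The Gaussian `L²` norm of a function. -/
noncomputable def gaussNorm (f : (Fin n → ℂ) → ℂ) : ℝ := (eLpNorm f 2 (gaussian b)).toReal

/-- Cauchy's estimate: the derivative is bounded by the Gaussian `L²` norm as well. -/
theorem exists_norm_le_gaussNorm (z₀ : Fin n → ℂ) :
    ∃ D : ℝ, ∀ f ∈ segalBargmann b, ∀ z ∈ Metric.ball z₀ 1,
      ‖f z‖ ≤ D * gaussNorm b f ∧ ‖fderiv ℂ f z‖ ≤ D * gaussNorm b f := by
  obtain ⟨D, hD, h⟩ := exists_enorm_le_eLpNorm b z₀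
  have h' : ∀ f ∈ segalBargmann b, ∀ z ∈ Metric.ball z₀ 2,
      ‖f z‖ ≤ D.toReal * gaussNorm b f := by
    intro f hf z hz
    have h1 := ENNReal.toReal_mono (ENNReal.mul_ne_top hD hf.2.2.ne) (h f hf.1 z hz)
    rwa [toReal_enorm, ENNReal.toReal_mul] at h1
  refine ⟨D.toReal, fun f hf z hz =>
    ⟨h' f hf z (Metric.ball_subset_ball one_le_two hz), ?_⟩⟩
  have hnn : 0 ≤ D.toReal * gaussNorm b f := by unfold gaussNorm; positivity
  refine ContinuousLinearMap.opNorm_le_bound _ hnn fun v => ?_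
  rcases eq_or_ne v 0 with rfl | hv
  · simp
  have hvp : 0 < ‖v‖ := norm_pos_iff.2 hv
  have hd : Differentiable ℂ fun c : ℂ => f (z + c • v) := hf.1.comp (by fun_prop)
  have hder : deriv (fun c : ℂ => f (z + c • v)) 0 = fderiv ℂ f z v := by
    have h1 : HasDerivAt (fun c : ℂ => z + c • v) v 0 := by
      simpa using ((hasDerivAt_id (0 : ℂ)).smul_const v).const_add z
    have h2 : HasFDerivAt f (fderiv ℂ f z) (z + (0 : ℂ) • v) := by
      simpa using (hf.1 z).hasFDerivAt
    exact (h2.comp_hasDerivAt (0 : ℂ) h1).deriv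
  -- the circle of radius `‖v‖⁻¹` in direction `v` has radius `1` and stays in `ball z₀ 2`
  have := Complex.norm_deriv_le_of_forall_mem_sphere_norm_le (c := 0) (R := ‖v‖⁻¹)
    (C := D.toReal * gaussNorm b f) (inv_pos.2 hvp) hd.diffContOnCl (fun c hc => by
      refine h' f hf _ ?_
      rw [mem_sphere_zero_iff_norm] at hc
      rw [Metric.mem_ball] at hz ⊢
      have : dist (z + c • v) z = 1 := by
        rw [dist_eq_norm, add_sub_cancel_left, norm_smul, hc, inv_mul_cancel₀ hvp.ne']
      linarith [dist_triangle (z + c • v) z z₀])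
  rwa [hder, div_inv_eq_mul] at this

/-- A sequence in the Segal-Bargmann space which is Cauchy for the Gaussian `L²` norm converges
pointwise to an entire function. -/
theorem exists_differentiable_limit {f : ℕ → (Fin n → ℂ) → ℂ} (hf : ∀ k, f k ∈ segalBargmann b)
    (hc : ∀ ε > 0, ∃ N, ∀ k ≥ N, ∀ l ≥ N, gaussNorm b (f k - f l) < ε) :
    ∃ g : (Fin n → ℂ) → ℂ, Differentiable ℂ g ∧ ∀ z, Tendsto (fun k => f k z) atTop (𝓝 (g z)) := by
  have hunif : ∀ z₀ : Fin n → ℂ, ∀ ε > 0, ∃ N, ∀ k ≥ N, ∀ l ≥ N, ∀ z ∈ Metric.ball z₀ 1,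
      ‖f k z - f l z‖ < ε ∧ ‖fderiv ℂ (f k) z - fderiv ℂ (f l) z‖ < ε := by
    intro z₀ ε hε
    obtain ⟨D, hD⟩ := exists_norm_le_gaussNorm b z₀
    obtain ⟨N, hN⟩ := hc (ε / (|D| + 1)) (by positivity)
    refine ⟨N, fun k hk l hl z hz => ?_⟩
    have h1 := hD (f k - f l) (sub_mem (hf k) (hf l)) z hz
    rw [Pi.sub_apply, fderiv_sub ((hf k).1 z) ((hf l).1 z)] at h1
    have h2 : D * gaussNorm b (f k - f l) < ε := by
      have h3 := hN k hk l hl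
      rw [lt_div_iff₀ (by positivity)] at h3
      have h4 : 0 ≤ gaussNorm b (f k - f l) := ENNReal.toReal_nonneg
      nlinarith [le_abs_self D]
    exact ⟨h1.1.trans_lt h2, h1.2.trans_lt h2⟩
  have hlim : ∀ z, ∃ y, Tendsto (fun k => f k z) atTop (𝓝 y) := by
    intro z
    refine cauchySeq_tendsto_of_complete (Metric.cauchySeq_iff.2 fun ε hε => ?_)
    obtain ⟨N, hN⟩ := hunif z ε hε
    exact ⟨N, fun k hk l hl => by
      rw [dist_eq_norm]
      exact (hN k hk l hl z (Metric.mem_ball_self one_pos)).1⟩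
  have hlim' : ∀ z, ∃ y, Tendsto (fun k => fderiv ℂ (f k) z) atTop (𝓝 y) := by
    intro z
    refine cauchySeq_tendsto_of_complete (Metric.cauchySeq_iff.2 fun ε hε => ?_)
    obtain ⟨N, hN⟩ := hunif z ε hε
    exact ⟨N, fun k hk l hl => by
      rw [dist_eq_norm]
      exact (hN k hk l hl z (Metric.mem_ball_self one_pos)).2⟩
  choose g hg using hlim
  choose g' hg' using hlim'
  refine ⟨g, fun z₀ => ?_, hg⟩
  have hcu : UniformCauchySeqOn (fun k => fderiv ℂ (f k)) atTop (Metric.ball z₀ 1) := by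
    refine Metric.uniformCauchySeqOn_iff.2 fun ε hε => ?_
    obtain ⟨N, hN⟩ := hunif z₀ ε hε
    exact ⟨N, fun k hk l hl z hz => by
      rw [dist_eq_norm]
      exact (hN k hk l hl z hz).2⟩
  have := hasFDerivAt_of_tendstoUniformlyOn Metric.isOpen_ball
    (hcu.tendstoUniformlyOn_of_tendsto fun z _ => hg' z)
    (fun k z _ => ((hf k).1 z).hasFDerivAt) (fun z _ => hg z) (Metric.mem_ball_self one_pos)
  exact this.differentiableAt

end Gaussian

/-! ### Reproducing kernels of closed spaces of entire functions -/

section Kernel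

variable {n : ℕ} {Q : Type*} [TopologicalSpace Q] [ChartedSpace (Euc n) Q]
  [RiemannianBundle (fun q : Q => TQ (n := n) q)] {q : Q}
  (b : Module.Basis (Fin n) ℝ (TQ (n := n) q))

/-- A space of functions in the Segal-Bargmann space which contains all its pointwise limits in the
Segal-Bargmann space. -/
structure IsKernelSpace (S : Submodule ℂ ((Fin n → ℂ) → ℂ)) : Prop where
  le : S ≤ segalBargmann b
  closed : ∀ (f : ℕ → (Fin n → ℂ) → ℂ) (g : (Fin n → ℂ) → ℂ), (∀ k, f k ∈ S) →
    g ∈ segalBargmann b → (∀ z, Tendsto (fun k => f k z) atTop (𝓝 (g z))) → g ∈ S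

variable {b} {S : Submodule ℂ ((Fin n → ℂ) → ℂ)}

/-- The inclusion of a space of square integrable entire functions in `L²`. -/
noncomputable def toL2 (hS : IsKernelSpace b S) : S →ₗ[ℂ] Lp ℂ 2 (gaussian b) where
  toFun f := MemLp.toLp f.1 (hS.le f.2).2
  map_add' _ _ := rfl
  map_smul' _ _ := rfl

theorem coeFn_toL2 (hS : IsKernelSpace b S) (f : S) : toL2 hS f =ᵐ[gaussian b] f.1 :=
  MemLp.coeFn_toLp (hS.le f.2).2

theorem toL2_injective (hS : IsKernelSpace b S) : Function.Injective (toL2 hS) := by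
  intro f g h
  refine Subtype.ext (eq_of_ae_eq_gaussian b (hS.le f.2).1.continuous (hS.le g.2).1.continuous ?_)
  exact (coeFn_toL2 hS f).symm.trans ((congrArg (fun x : Lp ℂ 2 (gaussian b) =>
    (x : (Fin n → ℂ) → ℂ)) h).eventuallyEq.trans (coeFn_toL2 hS g))

theorem norm_toL2 (hS : IsKernelSpace b S) (f : S) : ‖toL2 hS f‖ = gaussNorm b f.1 :=
  Lp.norm_toLp f.1 (hS.le f.2).2

theorem inner_toL2 (hS : IsKernelSpace b S) (f g : S) :
    inner ℂ (toL2 hS f) (toL2 hS g) = scalar b f.1 g.1 := by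
  rw [L2.inner_def, scalar]
  refine integral_congr_ae ?_
  filter_upwards [coeFn_toL2 hS f, coeFn_toL2 hS g] with z hf hg
  rw [hf, hg, RCLike.inner_apply, mul_comm]

theorem norm_toL2_sq (hS : IsKernelSpace b S) (f : S) :
    ‖toL2 hS f‖ ^ 2 = ∫ z, ‖f.1 z‖ ^ 2 ∂(gaussian b) := by
  have h := inner_self_eq_norm_sq_to_K (𝕜 := ℂ) (toL2 hS f)
  rw [inner_toL2, scalar] at h
  have h2 : ∀ z, conj (f.1 z) * f.1 z = ((‖f.1 z‖ ^ 2 : ℝ) : ℂ) := fun z => by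
    rw [Complex.conj_mul', Complex.ofReal_pow]
  simp_rw [h2] at h
  rw [integral_complex_ofReal] at h
  refine Complex.ofReal_injective ?_
  rw [Complex.ofReal_pow]
  exact h.symm

/-- The image in `L²` is closed: an `L²` limit is a locally uniform limit, by the mean value
inequality. -/
theorem isClosed_range_toL2 (hS : IsKernelSpace b S) :
    IsClosed ((LinearMap.range (toL2 hS) : Submodule ℂ _) : Set (Lp ℂ 2 (gaussian b))) := by
  refine isClosed_of_closure_subset fun x hx => ?_
  obtain ⟨y, hy, hyx⟩ := mem_closure_iff_seq_limit.1 hx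
  choose f hf using hy
  have hfx : Tendsto (fun k => toL2 hS (f k)) atTop (𝓝 x) := by simpa [hf] using hyx
  obtain ⟨g, hg, hlim⟩ := exists_differentiable_limit b (f := fun k => (f k).1)
    (fun k => hS.le (f k).2) (fun ε hε => by
      obtain ⟨N, hN⟩ := Metric.cauchySeq_iff.1 hfx.cauchySeq ε hε
      refine ⟨N, fun k hk l hl => ?_⟩
      have := hN k hk l hl
      rwa [dist_eq_norm, ← map_sub, norm_toL2] at this)
  have hgx : g =ᵐ[gaussian b] x := by
    obtain ⟨ns, hns, hae⟩ := (tendstoInMeasure_of_tendsto_Lp hfx).exists_seq_tendsto_ae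
    have hall : ∀ᵐ z ∂(gaussian b), ∀ k, toL2 hS (f k) z = (f k).1 z :=
      ae_all_iff.2 fun k => coeFn_toL2 hS (f k)
    filter_upwards [hae, hall] with z h1 h2
    simp_rw [h2] at h1
    exact tendsto_nhds_unique ((hlim z).comp hns.tendsto_atTop) h1
  have hgB : g ∈ segalBargmann b := ⟨hg, (memLp_congr_ae hgx).2 (Lp.memLp x)⟩
  refine ⟨⟨g, hS.closed _ g (fun k => (f k).2) hgB hlim⟩, ?_⟩
  exact Lp.ext ((coeFn_toL2 hS _).trans hgx)

/-- The identification of the function space with its image in `L²`. -/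
noncomputable def rangeEquiv (hS : IsKernelSpace b S) : S ≃ₗ[ℂ] LinearMap.range (toL2 hS) :=
  LinearEquiv.ofInjective (toL2 hS) (toL2_injective hS)

theorem norm_rangeEquiv (hS : IsKernelSpace b S) (f : S) : ‖rangeEquiv hS f‖ = ‖toL2 hS f‖ := rfl

theorem inner_rangeEquiv (hS : IsKernelSpace b S) (f g : S) :
    inner ℂ (rangeEquiv hS f) (rangeEquiv hS g) = scalar b f.1 g.1 :=
  inner_toL2 hS f g

theorem completeSpace_range_toL2 (hS : IsKernelSpace b S) :
    CompleteSpace (LinearMap.range (toL2 hS)) :=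
  (isClosed_range_toL2 hS).completeSpace_coe

/-- Evaluation at a point is represented by a function in the space. -/
theorem exists_kernel (hS : IsKernelSpace b S) :
    ∃ k : (Fin n → ℂ) → (Fin n → ℂ) → ℂ, (∀ w, k w ∈ S) ∧ ∀ f ∈ S, ∀ w, scalar b (k w) f = f w := by
  have := completeSpace_range_toL2 hS
  have hex : ∀ w, ∃ g : S, ∀ f : S, scalar b g.1 f.1 = f.1 w := by
    intro w
    obtain ⟨D, hD⟩ := exists_norm_le_gaussNorm b w
    let ev : LinearMap.range (toL2 hS) →ₗ[ℂ] ℂ :=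
      (LinearMap.proj w ∘ₗ S.subtype) ∘ₗ (rangeEquiv hS).symm.toLinearMap
    let ev' : LinearMap.range (toL2 hS) →L[ℂ] ℂ := ev.mkContinuous D fun x => by
      obtain ⟨f, rfl⟩ := (rangeEquiv hS).surjective x
      have h1 := (hD f.1 (hS.le f.2) w (Metric.mem_ball_self one_pos)).1
      have h2 : ev (rangeEquiv hS f) = f.1 w := by simp [ev]
      rw [h2, norm_rangeEquiv, norm_toL2]
      exact h1
    refine ⟨(rangeEquiv hS).symm ((InnerProductSpace.toDual ℂ _).symm ev'), fun f => ?_⟩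
    rw [← inner_rangeEquiv hS, LinearEquiv.apply_symm_apply, InnerProductSpace.toDual_symm_apply]
    simp [ev', ev]
  choose k hk using hex
  exact ⟨fun w => (k w).1, fun w => (k w).2, fun f hf w => hk w ⟨f, hf⟩⟩

/-- A function in the space is determined by its scalar products. -/
theorem eq_of_scalar_eq (hS : IsKernelSpace b S) {f g : (Fin n → ℂ) → ℂ} (hf : f ∈ S)
    (hg : g ∈ S) (h : ∀ u ∈ S, scalar b f u = scalar b g u) : f = g := by
  have h1 : rangeEquiv hS ⟨f, hf⟩ = rangeEquiv hS ⟨g, hg⟩ := by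
    refine ext_inner_right ℂ fun x => ?_
    obtain ⟨u, rfl⟩ := (rangeEquiv hS).surjective x
    rw [inner_rangeEquiv, inner_rangeEquiv]
    exact h u.1 u.2
  exact congrArg Subtype.val ((rangeEquiv hS).injective h1)

theorem scalar_sub_right (hS : IsKernelSpace b S) {f g u : (Fin n → ℂ) → ℂ} (hf : f ∈ S)
    (hg : g ∈ S) (hu : u ∈ S) :
    scalar b u (fun z => f z - g z) = scalar b u f - scalar b u g := by
  have h := inner_toL2 hS ⟨u, hu⟩ (⟨f, hf⟩ - ⟨g, hg⟩)
  rw [map_sub, inner_sub_right, inner_toL2, inner_toL2] at h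
  exact h.symm

theorem conj_scalar (f g : (Fin n → ℂ) → ℂ) : conj (scalar b f g) = scalar b g f := by
  rw [scalar, scalar, ← integral_conj]
  refine integral_congr_ae (Eventually.of_forall fun z => ?_)
  simp [mul_comm]

/-- Expansion of the kernel in an orthonormal basis: Parseval's identity for the representatives of
two evaluations. -/
theorem hasSum_kernel (hS : IsKernelSpace b S) {k : (Fin n → ℂ) → (Fin n → ℂ) → ℂ}
    (hk : ∀ w, k w ∈ S) (hrep : ∀ f ∈ S, ∀ w, scalar b (k w) f = f w) {ι : Type*} [DecidableEq ι]
    {e : ι → (Fin n → ℂ) → ℂ} (he : ∀ j, e j ∈ S)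
    (horth : ∀ i j, scalar b (e i) (e j) = if i = j then 1 else 0)
    (hdense : ∀ f ∈ S, ∀ ε : ℝ, 0 < ε → ∃ ψ ∈ Submodule.span ℂ (range e),
      ∫ z, ‖f z - ψ z‖ ^ 2 ∂(gaussian b) < ε) (z w : Fin n → ℂ) :
    HasSum (fun j => e j z * conj (e j w)) (k w z) := by
  have := completeSpace_range_toL2 hS
  let v : ι → LinearMap.range (toL2 hS) := fun j => rangeEquiv hS ⟨e j, he j⟩
  have hv : Orthonormal ℂ v := by
    refine orthonormal_iff_ite.2 fun i j => ?_
    rw [inner_rangeEquiv, horth]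
  have hspan : ∀ ψ ∈ Submodule.span ℂ (range e), ∃ h : ψ ∈ S,
      rangeEquiv hS ⟨ψ, h⟩ ∈ Submodule.span ℂ (range v) := by
    intro ψ hψ
    induction hψ using Submodule.span_induction with
    | mem x hx =>
      obtain ⟨j, rfl⟩ := hx
      exact ⟨he j, Submodule.subset_span ⟨j, rfl⟩⟩
    | zero => exact ⟨S.zero_mem, by
        have : (⟨0, S.zero_mem⟩ : S) = 0 := rfl
        rw [this, map_zero]
        exact Submodule.zero_mem _⟩
    | add x y _ _ hx hy =>
      obtain ⟨hx, hx'⟩ := hx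
      obtain ⟨hy, hy'⟩ := hy
      exact ⟨S.add_mem hx hy, Submodule.add_mem _ hx' hy'⟩
    | smul c x _ hx =>
      obtain ⟨hx, hx'⟩ := hx
      exact ⟨S.smul_mem c hx, Submodule.smul_mem _ c hx'⟩
  have htop : ⊤ ≤ (Submodule.span ℂ (range v)).topologicalClosure := by
    intro x _
    obtain ⟨f, rfl⟩ := (rangeEquiv hS).surjective x
    refine Metric.mem_closure_iff.2 fun ε hε => ?_
    obtain ⟨ψ, hψ, hlt⟩ := hdense f.1 f.2 (ε ^ 2) (by positivity)
    obtain ⟨hψS, hmem⟩ := hspan ψ hψ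
    refine ⟨_, hmem, ?_⟩
    rw [dist_eq_norm, ← map_sub, norm_rangeEquiv]
    refine lt_of_pow_lt_pow_left₀ 2 hε.le ?_
    rw [norm_toL2_sq]
    exact hlt
  let B : HilbertBasis ι ℂ (LinearMap.range (toL2 hS)) := HilbertBasis.mk hv htop
  have hB : ∀ j, B j = v j := fun j => by rw [HilbertBasis.coe_mk]
  have hsum := B.hasSum_inner_mul_inner (rangeEquiv hS ⟨k z, hk z⟩) (rangeEquiv hS ⟨k w, hk w⟩)
  simp only [hB, v, inner_rangeEquiv] at hsum
  rw [hrep _ (hk w)] at hsum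
  refine hsum.congr_fun fun j => ?_
  rw [hrep _ (he j), ← conj_scalar, hrep _ (he j)]

end Kernel

/-! ### The kernels of the phase space and of its tangent space -/

section Main

variable {n : ℕ} {Q : Type*} [TopologicalSpace Q] [ChartedSpace (Euc n) Q]
  [RiemannianBundle (fun q : Q => TQ (n := n) q)]

theorem isKernelSpace_segalBargmann {q : Q} (b : Module.Basis (Fin n) ℝ (TQ (n := n) q)) :
    IsKernelSpace b (segalBargmann b) :=
  ⟨le_rfl, fun _ _ _ hg _ => hg⟩

/-- The pull-backs to the tangent space of the functions in `𝓑_P` are closed under pointwise limits,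
because a pointwise limit of functions which are constant on the fibres of `exp_o` is so too. -/
theorem isKernelSpace_map_expPullback [T2Space Q] (hflat : IsFlat n Q)
    (hcomplete : GeodesicallyComplete n Q) (o : Phase n Q)
    (b : Module.Basis (Fin n) ℝ (TQ (n := n) o.proj))
    (hsurj : Function.Surjective (expMap o b)) :
    IsKernelSpace b ((holoL2 o b).map (expPullback o b)) where
  le := by
    rintro _ ⟨φ, hφ, rfl⟩
    exact ⟨(holomorphic_iff hflat hcomplete o b hsurj φ).1 hφ.1, hφ.2⟩
  closed f g hf hg hlim := by
    choose φ hφ hφf using hf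
    have hg' : ∀ z, g (Function.surjInv hsurj (expMap o b z)) = g z := by
      intro z
      refine tendsto_nhds_unique (hlim _) ?_
      convert hlim z using 2 with k
      rw [← hφf k]
      exact congrArg (φ k) (Function.surjInv_eq hsurj _)
    refine ⟨fun m => g (Function.surjInv hsurj m), ⟨?_, ?_⟩, funext hg'⟩
    · rw [holomorphic_iff hflat hcomplete o b hsurj]
      simp_rw [hg']
      exact hg.1
    · simp_rw [hg']
      exact hg.2

end Main

end FlatPhaseSpace

theorem mainTheorem2 (n : ℕ) {Q : Type*} [TopologicalSpace Q] [T2Space Q] [ConnectedSpace Q]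
    [ChartedSpace (FlatPhaseSpace.Euc n) Q] [IsManifold 𝓘(ℝ, FlatPhaseSpace.Euc n) ∞ Q]
    [RiemannianBundle (fun q : Q => FlatPhaseSpace.TQ (n := n) q)]
    [IsContMDiffRiemannianBundle 𝓘(ℝ, FlatPhaseSpace.Euc n) ∞ (FlatPhaseSpace.Euc n)
      (fun q : Q => FlatPhaseSpace.TQ (n := n) q)]
    (hflat : FlatPhaseSpace.IsFlat n Q)
    (hcomplete : FlatPhaseSpace.GeodesicallyComplete n Q)
    (o : FlatPhaseSpace.Phase n Q)
    (b : Module.Basis (Fin n) ℝ (FlatPhaseSpace.TQ (n := n) o.proj))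
    (hsurj : Function.Surjective (FlatPhaseSpace.expMap o b))
    {ι : Type*} (e : ι → FlatPhaseSpace.Phase n Q → ℂ)
    (he : FlatPhaseSpace.IsOrthonormalBasis o b e) :
    (∀ m m' : FlatPhaseSpace.Phase n Q, Summable (fun j => ‖e j m * conj (e j m')‖)) ∧
    ∃ KP : FlatPhaseSpace.Phase n Q → FlatPhaseSpace.Phase n Q → ℂ,
      FlatPhaseSpace.IsReproducingKernel o b KP ∧
      (∀ K', FlatPhaseSpace.IsReproducingKernel o b K' → K' = KP) ∧
      (∀ m m' : FlatPhaseSpace.Phase n Q, HasSum (fun j => e j m * conj (e j m')) (KP m m')) ∧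
      ∃ K : (Fin n → ℂ) → (Fin n → ℂ) → ℂ,
        FlatPhaseSpace.IsSegalBargmannKernel b K ∧
        (∀ K', FlatPhaseSpace.IsSegalBargmannKernel b K' → K' = K) ∧
        ∀ w : Fin n → ℂ, FlatPhaseSpace.IsOrthogonalProjection b
          ((FlatPhaseSpace.holoL2 o b).map (FlatPhaseSpace.expPullback o b))
          (fun z => K z w)
          (fun z => KP (FlatPhaseSpace.expMap o b z) (FlatPhaseSpace.expMap o b w)) := by
  classical
  open FlatPhaseSpace in
  have hB := isKernelSpace_segalBargmann b
  have hP := isKernelSpace_map_expPullback hflat hcomplete o b hsurj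
  set S := (holoL2 o b).map (expPullback o b)
  have hpull : ∀ φ ∈ holoL2 o b, (fun z => φ (expMap o b z)) ∈ S := fun φ hφ => ⟨φ, hφ, rfl⟩
  obtain ⟨k, hkB, hk⟩ := exists_kernel hB
  obtain ⟨l, hlS, hl⟩ := exists_kernel hP
  have hsymm_k : ∀ z w, conj (k z w) = k w z := fun z w => by
    rw [← hk _ (hkB w), ← hk _ (hkB z), conj_scalar]
  have hsymm_l : ∀ z w, conj (l z w) = l w z := fun z w => by
    rw [← hl _ (hlS w), ← hl _ (hlS z), conj_scalar]
  -- `l w z` depends on `z` and `w` only through their images under the exponential map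
  have hl_left : ∀ w z z', expMap o b z = expMap o b z' → l w z = l w z' := by
    intro w z z' h
    obtain ⟨φ, -, hφ⟩ := hlS w
    rw [← hφ]
    exact congrArg φ h
  set s := Function.surjInv hsurj
  have hs : ∀ m, expMap o b (s m) = m := Function.surjInv_eq hsurj
  -- the kernel of `𝓑_P` is that of the pull-backs, read at chosen preimages
  let KP : Phase n Q → Phase n Q → ℂ := fun m m' => l (s m') (s m)
  have hKP : ∀ z w, KP (expMap o b z) (expMap o b w) = l w z := by
    intro z w
    change l (s (expMap o b w)) (s (expMap o b z)) = l w z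
    rw [hl_left _ _ z (hs _), ← hsymm_l, hl_left _ _ w (hs _), hsymm_l]
  have hKPl : ∀ m' z, KP (expMap o b z) m' = l (s m') z := fun m' z => by
    rw [← hKP, hs]
  have hKPr : ∀ m w, conj (KP m (expMap o b w)) = l (s m) w := fun m w => by
    rw [← hsymm_l, ← hKP, hs]
  have hsum : ∀ m m' : Phase n Q, HasSum (fun j => e j m * conj (e j m')) (KP m m') := by
    intro m m'
    have := hasSum_kernel hP hlS hl (e := fun j z => e j (expMap o b z))
      (fun j => hpull _ (he.mem j)) (fun i j => he.orthonormal i j) (by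
        rintro _ ⟨φ, hφ, rfl⟩ ε hε
        obtain ⟨ψ, hψ, hlt⟩ := he.dense φ hφ ε hε
        refine ⟨expPullback o b ψ, ?_, hlt⟩
        have h1 := Submodule.mem_map_of_mem (f := expPullback o b) hψ
        rw [Submodule.map_span, ← range_comp] at h1
        exact h1) (s m) (s m')
    simpa only [hs] using this
  refine ⟨fun m m' => (hsum m m').summable.norm, KP, ⟨?_, ?_, ?_⟩, ?_, hsum,
    fun z w => k w z, ⟨hkB, ?_, ?_⟩, ?_, ?_⟩
  · intro m'
    rw [holomorphic_iff hflat hcomplete o b hsurj]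
    simp_rw [hKPl]
    exact (hP.le (hlS _)).1
  · intro m
    refine ⟨?_, ?_⟩
    · rw [holomorphic_iff hflat hcomplete o b hsurj]
      simp_rw [hKPr]
      exact (hP.le (hlS _)).1
    · simp_rw [hKPr]
      exact (hP.le (hlS _)).2
  · intro φ hφ m
    have h1 := hl _ (hpull φ hφ) (s m)
    rw [hs] at h1
    rw [← h1, scalar]
    simp_rw [← hKPr, Complex.conj_conj]
  · intro K' hK'
    funext m m'
    have h1 : (fun w => conj (K' m (expMap o b w))) = l (s m) := by
      refine eq_of_scalar_eq hP (hpull _ (hK'.conj_mem m)) (hlS _) ?_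
      rintro _ ⟨φ, hφ, rfl⟩
      refine Eq.trans ?_ (hl _ (hpull φ hφ) (s m)).symm
      rw [hs, hK'.reproducing φ hφ m, scalar]
      simp only [Complex.conj_conj]
      rfl
    have h2 := congrFun h1 (s m')
    rw [← hKPr, hs] at h2
    exact (starRingEnd ℂ).injective h2
  · intro z
    simp_rw [← hsymm_k z, Complex.conj_conj]
    exact hkB z
  · intro f hf z
    rw [← hk f hf z, scalar]
    simp_rw [hsymm_k]
  · intro K' hK'
    funext z w
    have h1 : (fun w => conj (K' z w)) = k z := by
      refine eq_of_scalar_eq hB (hK'.conj_mem z) (hkB z) fun f hf => ?_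
      rw [hk f hf, hK'.reproducing f hf z, scalar]
      simp only [Complex.conj_conj]
    rw [← hsymm_k, ← h1, Complex.conj_conj]
  · intro w
    simp_rw [hKP]
    refine ⟨hlS w, fun h hh => ?_⟩
    rw [scalar_sub_right hB (hkB w) (hP.le (hlS w)) (hP.le hh), ← conj_scalar _ h, ← conj_scalar _ h,
      hk h (hP.le hh), hl h hh, sub_self]
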